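/- Let $X$ be a finite set with at least two elements and let $G$ be a group acting faithfully on the set $X^*$ of finite words so that the action is self-similar: for all $g\in G$, $x\in X$ there are $g(x)\in X$ and $g|_x\in G$ with $g(xw)=g(x)\,g|_x(w)$ for all $w\in X^*$; put $g|_{x_1\ldots x_n}=g|_{x_1}|_{x_2}\cdots|_{x_n}$. Assume that $G$ is generated by a bounded automaton, i.e. by a finite set $S\subset G$ that is closed under restrictions and for which the number of paths of length $n$ in $S\setminus\{1\}$ (arrows $s\to s|_x$ labeled $x|s(x)$) is bounded independently of $n$. Such a group is contracting; let $\mathcal N$ be its nucleus, the smallest finite subset of $G$ that contains, for every $g\in G$, all restrictions $g|_v$ with $|v|$ large enough. View $\mathcal N$ as an automaton with arrows $g\to g|_x$ labeled $x|g(x)$. The tile $\mathcal T$ is the image of $X^{-\omega}\times\{1\}$ in the limit $G$-space, which is the quotient of $X^{-\omega}\times G$ (product topology of discrete sets, $X^{-\omega}$ being the set of left-infinite sequences $\ldots x_2x_1$) by the equivalence relation under which $\ldots x_2x_1\cdot g$ and $\ldots y_2y_1\cdot h$ are equivalent if some left-infinite path in $\mathcal N$ is labeled by $\ldots x_2x_1|\ldots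 y_2y_1$ and ends in $hg^{-1}$. Consider $\mathcal T$ as a topological space with the induced topology and assume that it is connected. For $v\in X^n$ let $\mathcal T_v\subset\mathcal T$ be the set of points represented by sequences that end in $v$ (a tile of level $n$). The post-critical set consists of the sequences $\ldots x_2x_1$ for which there is a left-infinite path in $\mathcal N\setminus\{1\}$ labeled by $\ldots x_2x_1|\ldots y_2y_1$ for some $y_i\in X$; the points of $\mathcal T$ represented by post-critical sequences are called boundary points. A point of $\mathcal T$ is regular if it does not lie in two different tiles of the same level, i.e. in $\mathcal T_v\cap\mathcal T_u$ for distinct words $v,u$ with $|v|=|u|$. For $A\subset\mathcal T$ let $bc(A)$ be the number of connected components of $A$ that contain a boundary point of $\mathcal T$. Let $T_n$ be the graph with vertex set $X^n$ in which $v\ne u$ are adjacent if $s(v)=u$ and $s|_v=1$ (or $s(u)=v$ and $s|_u=1$) for some $s\in\mathcal N$, and for $v\in X^n$ let $pc(T_n\setminus v)$ be the number of connected components of $T_n$ with the vertex $v$ and its edges removed that contain a post-critical vertex, i.e. a vertex $p_n\ldots p_2p_1$ with $\ldots p_2p_1$ post-critical. Let $t\in\mathcal T$ be a regular point represented by a sequence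 $\ldots x_2x_1$. Then $bc(\mathcal T\setminus\{t\})$ is finite, both limits below exist, and \[ bc(\mathcal T\setminus \{t\})=\lim_{n\to\infty} bc\bigl(\mathcal T\setminus \mathrm{int}(\mathcal T_{x_n\ldots x_2x_1})\bigr)=\lim_{n\to\infty} pc(T_n\setminus x_n\ldots x_2x_1), \] where the interior is taken in $\mathcal T$. -/

import Mathlib

noncomputable section

namespace SelfSimilarTile

/-- A faithful action of `G` on the set `X^*` of finite words (`List X`) is self-similar if for all
`g ∈ G`, `x ∈ X` there are `y ∈ X`, `h ∈ G` with `g (x w) = y h(w)` for all words `w`. -/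
class SelfSimilar (G X : Type*) [Group G] [MulAction G (List X)] : Prop
    extends FaithfulSMul G (List X) where
  exists_restriction : ∀ (g : G) (x : X), ∃ (y : X) (h : G), ∀ w : List X,
    g • (x :: w) = y :: h • w

section Group

variable {G X : Type*} [Group G] [MulAction G (List X)] [SelfSimilar G X]

/-- The letter `g(x)`. -/
def onLetter (g : G) (x : X) : X :=
  (SelfSimilar.exists_restriction g x).choose

/-- The restriction `g|_x` of `g` at the letter `x`. -/
def restr (g : G) (x : X) : G :=
  (SelfSimilar.exists_restriction g x).choose_spec.choose

theorem smul_cons (g : G) (x : X) (w : List X) :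
    g • (x :: w) = onLetter g x :: restr g x • w :=
  (SelfSimilar.exists_restriction g x).choose_spec.choose_spec w

/-- The letter `g(x)` and the restriction `g|_x` are uniquely determined. -/
theorem restr_unique {g : G} {x y : X} {h : G} (H : ∀ w : List X, g • (x :: w) = y :: h • w) :
    onLetter g x = y ∧ restr g x = h := by
  have key : ∀ w : List X, onLetter g x = y ∧ restr g x • w = h • w := by
    intro w
    have := (smul_cons g x w).symm.trans (H w)
    simpa using this
  exact ⟨(key []).1, eq_of_smul_eq_smul (fun w : List X => (key w).2)⟩

/-- The restriction `g|_v` at a word `v = x₁x₂…xₙ`, i.e. `g|_{x₁}|_{x₂}…|_{xₙ}`. -/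
def restrWord : G → List X → G
  | g, [] => g
  | g, x :: v => restrWord (restr g x) v

end Group

section Nucleus

variable (G X : Type*) [Group G] [MulAction G (List X)] [SelfSimilar G X]

/-- A finite set `N ⊆ G` such that for every `g ∈ G` all restrictions of `g` at sufficiently long
words lie in `N`. The group is contracting if such a set exists. -/
def IsContractingSet (N : Set G) : Prop :=
  N.Finite ∧ ∀ g : G, ∃ n : ℕ, ∀ v : List X, n ≤ v.length → restrWord g v ∈ N

/-- The nucleus of a contracting group: the smallest finite set that contains all restrictions of
each `g ∈ G` at sufficiently long words (the intersection of all such sets). -/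
def nucleus : Set G := ⋂₀ {N : Set G | IsContractingSet G X N}

/-- In a contracting group the nucleus is itself a contracting set, hence the smallest one. -/
theorem isLeast_nucleus (h : ∃ N : Set G, IsContractingSet G X N) :
    IsLeast {N : Set G | IsContractingSet G X N} (nucleus G X) := by
  refine ⟨?_, fun N hN => Set.sInter_subset_of_mem hN⟩
  have hinter : ∀ A B : Set G, IsContractingSet G X A → IsContractingSet G X B →
      IsContractingSet G X (A ∩ B) := by
    rintro A B ⟨hA, hA'⟩ ⟨_, hB'⟩
    refine ⟨hA.subset Set.inter_subset_left, fun g => ?_⟩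
    obtain ⟨m, hm⟩ := hA' g
    obtain ⟨n, hn⟩ := hB' g
    exact ⟨max m n, fun v hv => ⟨hm v (le_trans (le_max_left _ _) hv),
      hn v (le_trans (le_max_right _ _) hv)⟩⟩
  have hex : ∃ k : ℕ, ∃ N : Set G, IsContractingSet G X N ∧ N.ncard = k :=
    h.elim fun N hN => ⟨_, N, hN, rfl⟩
  classical
  obtain ⟨A, hA, hk⟩ := Nat.find_spec hex
  have hsub : ∀ B : Set G, IsContractingSet G X B → A ⊆ B := by
    intro B hB
    have h1 := Nat.find_min' hex ⟨A ∩ B, hinter A B hA hB, rfl⟩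
    have h2 : A ∩ B = A := Set.eq_of_subset_of_ncard_le Set.inter_subset_left (hk ▸ h1) hA.1
    exact h2 ▸ Set.inter_subset_right
  have heq : nucleus G X = A :=
    Set.Subset.antisymm (Set.sInter_subset_of_mem hA) (Set.subset_sInter fun B hB => hsub B hB)
  exact heq ▸ hA

/-- `S ⊆ G` is (the set of states of) a bounded automaton: it is finite, closed under restrictions,
and the number of paths of length `n` in `S \ {1}` is bounded independently of `n`. A path of length
`n` is given by its initial state `s` and its input word `v`; its vertices are the states `s|_u` for
the prefixes `u` of `v`. -/
def IsBoundedAutomaton (S : Set G) : Prop :=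
  S.Finite ∧ (∀ s ∈ S, ∀ x : X, restr s x ∈ S) ∧
    ∃ C : ℕ, ∀ n : ℕ, {p : G × List X | p.1 ∈ S ∧ p.2.length = n ∧
      ∀ u : List X, u <+: p.2 → restrWord p.1 u ≠ 1}.encard ≤ C

/-- `G` is generated by a bounded automaton. -/
def GeneratedByBoundedAutomaton : Prop :=
  ∃ S : Set G, IsBoundedAutomaton G X S ∧ Subgroup.closure S = ⊤

end Nucleus

/-- Left-infinite sequences `… x₃x₂x₁`; the term `ξ : LeftSeq X` has `ξ i = x_{i+1}`, so `ξ 0` is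
the last letter. -/
def LeftSeq (X : Type*) : Type _ := ℕ → X

/-- The product topology of discrete sets. -/
instance (X : Type*) : TopologicalSpace (LeftSeq X) :=
  @Pi.topologicalSpace ℕ (fun _ => X) (fun _ => ⊥)

/-- The word `xₙ … x₂x₁` formed by the last `n` letters of `… x₂x₁`. -/
def lastWord {X : Type*} (ξ : LeftSeq X) : ℕ → List X
  | 0 => []
  | n + 1 => ξ n :: lastWord ξ n

theorem length_lastWord {X : Type*} (ξ : LeftSeq X) (n : ℕ) : (lastWord ξ n).length = n := by
  induction n with
  | zero => rfl
  | succ n ih => simp [lastWord, ih]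

section Tile

variable {G X : Type*} [Group G] [MulAction G (List X)] [SelfSimilar G X]

/-- The states `… s₂, s₁, s₀` form a left-infinite path in the automaton `A ⊆ G` that is labeled by
the pair `… x₂x₁ | … y₂y₁` and ends in `s₀`: for each `n` there is an arrow from `s_{n+1}` to `sₙ`
labeled by `x_{n+1} | y_{n+1}`. -/
def IsLeftPath (A : Set G) (s : ℕ → G) (ξ η : LeftSeq X) : Prop :=
  (∀ n, s n ∈ A) ∧ ∀ n, onLetter (s (n + 1)) (ξ n) = η n ∧ restr (s (n + 1)) (ξ n) = s n

variable (G X)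

/-- The post-critical set: all sequences that can be read along left-infinite paths in the nucleus
with the trivial state removed. -/
def postCritical : Set (LeftSeq X) :=
  {ξ | ∃ (s : ℕ → G) (η : LeftSeq X), IsLeftPath (nucleus G X \ {1}) s ξ η}

/-- `… x₂x₁·g` and `… y₂y₁·h` are related if some left-infinite path in the nucleus ends in the
state `hg⁻¹` and is labeled by `… x₂x₁ | … y₂y₁`. -/
def asympRel (p q : LeftSeq X × G) : Prop :=
  ∃ s : ℕ → G, IsLeftPath (nucleus G X) s p.1 q.1 ∧ s 0 = q.2 * p.2⁻¹

/-- The limit `G`-space. -/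
def LimitGSpace : Type _ := Quot (asympRel G X)

/-- The quotient topology of the product topology on `X^{-ω} × G`, with `G` discrete. -/
instance : TopologicalSpace (LimitGSpace G X) :=
  TopologicalSpace.coinduced (Quot.mk (asympRel G X))
    (@instTopologicalSpaceProd (LeftSeq X) G inferInstance ⊥)

/-- The tile: the image of `X^{-ω} × {1}` in the limit `G`-space. -/
def tile : Set (LimitGSpace G X) :=
  Set.range fun ξ : LeftSeq X => Quot.mk (asympRel G X) (ξ, 1)

/-- The tile as a topological space of its own, with the topology induced from the limit
`G`-space. -/
abbrev Tile : Type _ := tile G X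

variable {X}

/-- The point of the tile represented by a left-infinite sequence. -/
def point (ξ : LeftSeq X) : Tile G X := ⟨Quot.mk (asympRel G X) (ξ, 1), ξ, rfl⟩

/-- The tile `𝒯_v` of level `|v|`: the points represented by the sequences that end in `v`. -/
def levelTile (v : List X) : Set (Tile G X) :=
  point G '' {ξ | lastWord ξ v.length = v}

variable (X)

/-- The points represented by post-critical sequences. -/
def boundaryPoints : Set (Tile G X) := point G '' postCritical G X

variable {G X}

/-- A point is critical if it lies in two different tiles of the same level. -/
def IsCriticalPoint (t : Tile G X) : Prop :=
  ∃ v u : List X, v.length = u.length ∧ v ≠ u ∧ t ∈ levelTile G v ∩ levelTile G u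

/-- All other points are regular. -/
def IsRegularPoint (t : Tile G X) : Prop := ¬ IsCriticalPoint t

/-- The number of connected components of the subspace `A` of the tile that contain a boundary
point of the tile. -/
def bc (A : Set (Tile G X)) : ℕ∞ :=
  {C : Set (Tile G X) | (∃ x ∈ A, C = connectedComponentIn A x) ∧
    (C ∩ boundaryPoints G X).Nonempty}.encard

variable (G X)

/-- The tile graph `Tₙ` with respect to the nucleus: the vertices are the words of length `n`, and
`v ≠ u` are adjacent if `s(v) = u` and `s|_v = 1`, or `s(u) = v` and `s|_u = 1`, for some `s` in the
nucleus. -/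
def tileGraph (n : ℕ) : SimpleGraph {v : List X // v.length = n} :=
  SimpleGraph.fromRel fun v u => ∃ s ∈ nucleus G X, s • v.1 = u.1 ∧ restrWord s v.1 = 1

variable {X}

/-- The number of connected components of `Tₙ \ v` (the vertex `v` and all its edges removed) that
contain a post-critical vertex, i.e. a vertex `pₙ` with `p` post-critical. -/
def pc (n : ℕ) (v : {v : List X // v.length = n}) : ℕ∞ :=
  {c : ((tileGraph G X n).induce {u | u ≠ v}).ConnectedComponent |
    ∃ u ∈ c.supp, ∃ p ∈ postCritical G X, u.1.1 = lastWord p n}.encard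

end Tile

end SelfSimilarTile

end

open SelfSimilarTile Filter Topology

namespace SelfSimilarTile

/-! ### The calculus of actions and restrictions at words -/

section Words

variable {G X : Type*} [Group G] [MulAction G (List X)] [SelfSimilar G X]

/-! The complement of the interior of a level-`n` tile is the union `A n` of the other tiles of that
level (`compl_interior_levelTile`): these are finitely many closed connected sets. Two of them meet
exactly when their vertices are adjacent in the tile graph (`nonempty_inter_iff`), and one contains
a boundary point exactly when its vertex is post-critical. Hence the components of `A n` correspond
to those of the graph with a vertex deleted, and the `bc` and `pc` terms agree for every `n`
(`bc_compl_interior_eq_pc`).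

Along the nested tiles given by `ξ`, the sets `A n` increase. Regularity of `t` keeps `t` out of
each of them, and a point in all the tiles of `ξ` must be `t`, so they exhaust the complement of
`t`. Moreover every `z ≠ t` has a connected neighborhood inside some `A m`, namely the union of the
level-`m` tiles containing `z`. So the components of the complement are increasing unions of
components of the `A n` (`connectedComponentIn_eq_iUnion`). There are finitely many boundary points,
and whether two of them are joined is decided at a finite level; thus the counts are eventually
equal to the limit value (`eventually_encard_components_eq`).

Boundedness enters twice. It makes the group contracting
(`GeneratedByBoundedAutomaton.exists_isContractingSet`), because in a product of states the number
of nonfinitary factors can only drop, and while it is constant the product runs around a loop of one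
of finitely many types. It also makes the post-critical set finite (`finite_postCritical`), so that
distinct tiles of one level meet in finitely many points. -/

theorem smul_nil (g : G) : g • ([] : List X) = [] := by
  rcases h : g • ([] : List X) with _ | ⟨x, w⟩
  · rfl
  · have h1 : g⁻¹ • (x :: w) = [] := by rw [← h, inv_smul_smul]
    rw [smul_cons] at h1
    exact absurd h1 (by simp)

theorem length_smul (g : G) (v : List X) : (g • v).length = v.length := by
  induction v generalizing g with
  | nil => rw [smul_nil]
  | cons x w ih => rw [smul_cons, List.length_cons, List.length_cons, ih]

theorem smul_append (g : G) (v w : List X) : g • (v ++ w) = g • v ++ restrWord g v • w := by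
  induction v generalizing g with
  | nil => simp [smul_nil, restrWord]
  | cons x v ih => simp [smul_cons, restrWord, ih]

theorem onLetter_restr_one (x : X) :
    onLetter (1 : G) x = x ∧ restr (1 : G) x = 1 :=
  restr_unique fun w => by simp

@[simp] theorem onLetter_one (x : X) : onLetter (1 : G) x = x := (onLetter_restr_one x).1

@[simp] theorem restr_one (x : X) : restr (1 : G) x = 1 := (onLetter_restr_one x).2

theorem onLetter_restr_mul (g h : G) (x : X) :
    onLetter (g * h) x = onLetter g (onLetter h x) ∧
      restr (g * h) x = restr g (onLetter h x) * restr h x :=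
  restr_unique fun w => by rw [mul_smul, smul_cons h, smul_cons g, mul_smul]

theorem onLetter_mul (g h : G) (x : X) : onLetter (g * h) x = onLetter g (onLetter h x) :=
  (onLetter_restr_mul g h x).1

theorem restr_mul (g h : G) (x : X) : restr (g * h) x = restr g (onLetter h x) * restr h x :=
  (onLetter_restr_mul g h x).2

theorem onLetter_inv_onLetter (g : G) (x : X) : onLetter g⁻¹ (onLetter g x) = x := by
  rw [← onLetter_mul, inv_mul_cancel, onLetter_one]

theorem restr_inv (g : G) (x : X) : restr g⁻¹ (onLetter g x) = (restr g x)⁻¹ := by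
  rw [eq_inv_iff_mul_eq_one, ← restr_mul, inv_mul_cancel, restr_one]

@[simp] theorem restrWord_nil (g : G) : restrWord g ([] : List X) = g := rfl

@[simp] theorem restrWord_cons (g : G) (x : X) (v : List X) :
    restrWord g (x :: v) = restrWord (restr g x) v := rfl

@[simp] theorem restrWord_one (v : List X) : restrWord (1 : G) v = 1 := by
  induction v with
  | nil => rfl
  | cons x v ih => simp [ih]

theorem restrWord_append (g : G) (v w : List X) :
    restrWord g (v ++ w) = restrWord (restrWord g v) w := by
  induction v generalizing g with
  | nil => rfl
  | cons x v ih => simp [ih]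

theorem restrWord_mul (g h : G) (v : List X) :
    restrWord (g * h) v = restrWord g (h • v) * restrWord h v := by
  induction v generalizing g h with
  | nil => simp [smul_nil]
  | cons x v ih => simp [smul_cons, restr_mul, ih]

theorem restrWord_inv (g : G) (v : List X) : restrWord g⁻¹ (g • v) = (restrWord g v)⁻¹ := by
  rw [eq_inv_iff_mul_eq_one, ← restrWord_mul, inv_mul_cancel, restrWord_one]

theorem restrWord_inv' (g : G) (v : List X) : restrWord g⁻¹ v = (restrWord g (g⁻¹ • v))⁻¹ := by
  rw [← restrWord_inv, smul_inv_smul]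

theorem restrWord_mem {A : Set G} (hA : ∀ s ∈ A, ∀ x : X, restr s x ∈ A) {s : G} (hs : s ∈ A)
    (v : List X) : restrWord s v ∈ A := by
  induction v generalizing s with
  | nil => exact hs
  | cons x v ih => exact ih (hA s hs x)

theorem restrWord_eq_one_of_prefix {g : G} {u v : List X} (h : u <+: v)
    (hu : restrWord g u = 1) : restrWord g v = 1 := by
  obtain ⟨w, rfl⟩ := h
  rw [restrWord_append, hu, restrWord_one]

end Words

/-! ### Bounded elements -/

section Bounded

variable {G : Type*} (X : Type*) [Group G] [MulAction G (List X)] [SelfSimilar G X]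

/-- The words of length `n` at which `g` has a nontrivial restriction. -/
def activeWords (g : G) (n : ℕ) : Set (List X) := {v | v.length = n ∧ restrWord g v ≠ 1}

/-- The number of nontrivial restrictions at words of length `n` is bounded independently of `n`. -/
def IsBoundedElement (g : G) : Prop := ∃ C : ℕ, ∀ n, (activeWords X g n).encard ≤ C

variable {X}

theorem isBoundedElement_one : IsBoundedElement X (1 : G) :=
  ⟨0, fun n => by simp [activeWords]⟩

/-- A nontrivial restriction of the product at `v` needs one of `g` at `h • v` or of `h` at `v`, so
the bounds add up. -/
theorem IsBoundedElement.mul {g h : G} (hg : IsBoundedElement X g) (hh : IsBoundedElement X h) :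
    IsBoundedElement X (g * h) := by
  obtain ⟨C, hC⟩ := hg
  obtain ⟨D, hD⟩ := hh
  refine ⟨C + D, fun n => ?_⟩
  have hsub : activeWords X (g * h) n ⊆
      (fun v => h⁻¹ • v) '' activeWords X g n ∪ activeWords X h n := by
    rintro v ⟨hv, hne⟩
    by_cases h1 : restrWord h v = 1
    · refine Or.inl ⟨h • v, ⟨by rw [length_smul, hv], fun h2 => hne ?_⟩, inv_smul_smul _ _⟩
      rw [restrWord_mul, h1, h2, one_mul]
    · exact Or.inr ⟨hv, h1⟩
  calc _ ≤ _ := Set.encard_le_encard hsub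
    _ ≤ _ := Set.encard_union_le _ _
    _ ≤ (C : ℕ∞) + D := add_le_add ((Set.encard_image_le _ _).trans (hC n)) (hD n)
    _ = _ := by push_cast; rfl

theorem IsBoundedElement.inv {g : G} (hg : IsBoundedElement X g) : IsBoundedElement X g⁻¹ := by
  obtain ⟨C, hC⟩ := hg
  refine ⟨C, fun n => ?_⟩
  have hsub : activeWords X g⁻¹ n ⊆ (fun v => g • v) '' activeWords X g n := by
    rintro v ⟨hv, hne⟩
    refine ⟨g⁻¹ • v, ⟨by rw [length_smul, hv], fun h => hne ?_⟩, smul_inv_smul _ _⟩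
    rw [restrWord_inv', h, inv_one]
  exact (Set.encard_le_encard hsub).trans ((Set.encard_image_le _ _).trans (hC n))

/-- Restrictions of the identity are trivial, so a nontrivial restriction at `v` means that the
whole path reading `v` avoids 1. -/
theorem IsBoundedAutomaton.isBoundedElement {S : Set G} (hS : IsBoundedAutomaton G X S) {s : G}
    (hs : s ∈ S) : IsBoundedElement X s := by
  obtain ⟨-, -, C, hC⟩ := hS
  refine ⟨C, fun n => le_trans ?_ (hC n)⟩
  rw [← (Prod.mk_right_injective s).encard_image]
  apply Set.encard_le_encard
  rintro _ ⟨v, ⟨hv, hne⟩, rfl⟩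
  exact ⟨hs, hv, fun u hu h => hne (restrWord_eq_one_of_prefix hu h)⟩

theorem GeneratedByBoundedAutomaton.isBoundedElement (hG : GeneratedByBoundedAutomaton G X)
    (g : G) : IsBoundedElement X g := by
  obtain ⟨S, hS, hcl⟩ := hG
  have hg : g ∈ Subgroup.closure S := hcl ▸ Subgroup.mem_top g
  induction hg using Subgroup.closure_induction with
  | mem s hs => exact hS.isBoundedElement hs
  | one => exact isBoundedElement_one
  | mul _ _ _ _ h1 h2 => exact h1.mul h2
  | inv _ _ h => exact h.inv

/-- There is a finite set of states that is closed under restrictions and generates `G` as a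
monoid. -/
theorem GeneratedByBoundedAutomaton.exists_generating_states
    (hG : GeneratedByBoundedAutomaton G X) :
    ∃ S : Set G, S.Finite ∧ (∀ s ∈ S, ∀ x : X, restr s x ∈ S) ∧
      ∀ g : G, ∃ l : List G, (∀ s ∈ l, s ∈ S) ∧ l.prod = g := by
  obtain ⟨S, ⟨hfin, hcl, -⟩, hgen⟩ := hG
  refine ⟨S ∪ S⁻¹, hfin.union hfin.inv, ?_, fun g => ?_⟩
  · rintro s (hs | hs) x
    · exact Or.inl (hcl s hs x)
    · right
      rw [Set.mem_inv, ← restr_inv]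
      exact hcl _ hs _
  · have hg : g ∈ Subgroup.closure S := hgen ▸ Subgroup.mem_top g
    rw [← Subgroup.mem_toSubmonoid, Subgroup.closure_toSubmonoid] at hg
    exact Submonoid.exists_list_of_mem_closure hg

end Bounded

/-! ### Finitary elements, loops and their finiteness -/

section Contracting

variable {G : Type*} (X : Type*) [Group G] [MulAction G (List X)] [SelfSimilar G X]

/-- The elements whose restrictions at all words of length `D` are trivial. -/
def finitaryOfDepth (D : ℕ) : Subgroup G where
  carrier := {g | ∀ v : List X, v.length = D → restrWord g v = 1}
  one_mem' v _ := restrWord_one v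
  mul_mem' {g h} hg hh v hv := by
    rw [restrWord_mul, hg _ (by rw [length_smul, hv]), hh v hv, one_mul]
  inv_mem' {g} hg v hv := by
    rw [restrWord_inv', hg _ (by rw [length_smul, hv]), inv_one]

/-- The elements all of whose restrictions at sufficiently long words are trivial. -/
def IsFinitary (g : G) : Prop := ∃ D : ℕ, g ∈ finitaryOfDepth (G := G) X D

variable {X}

theorem restrWord_eq_one_of_finitaryOfDepth {D : ℕ} {g : G} (hg : g ∈ finitaryOfDepth X D)
    {v : List X} (hv : D ≤ v.length) : restrWord g v = 1 :=
  restrWord_eq_one_of_prefix (List.take_prefix D v) (hg _ (by simpa using hv))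

theorem finitaryOfDepth_mono {D E : ℕ} (h : D ≤ E) :
    finitaryOfDepth (G := G) X D ≤ finitaryOfDepth X E :=
  fun _ hg _ hv => restrWord_eq_one_of_finitaryOfDepth hg (hv ▸ h)

theorem restrWord_mem_finitaryOfDepth {D : ℕ} {g : G} (hg : g ∈ finitaryOfDepth X D)
    (v : List X) : restrWord g v ∈ finitaryOfDepth X D := fun w hw => by
  rw [← restrWord_append]
  exact restrWord_eq_one_of_finitaryOfDepth hg (by simp [hw])

theorem IsFinitary.restrWord {g : G} (hg : IsFinitary X g) (v : List X) :
    IsFinitary X (restrWord g v) :=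
  hg.imp fun _ h => restrWord_mem_finitaryOfDepth h v

theorem exists_depth {S : Set G} (hS : S.Finite) :
    ∃ D : ℕ, ∀ s ∈ S, IsFinitary X s → s ∈ finitaryOfDepth X D := by
  classical
  have h : ∀ s : G, ∃ D : ℕ, IsFinitary X s → s ∈ finitaryOfDepth X D := by
    intro s
    by_cases hs : IsFinitary X s
    · exact hs.imp fun D hD _ => hD
    · exact ⟨0, fun h => absurd h hs⟩
  choose d hd using h
  exact ⟨hS.toFinset.sup d, fun s hs hf =>
    finitaryOfDepth_mono (Finset.le_sup (f := d) (hS.mem_toFinset.2 hs)) (hd s hf)⟩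

/-- Elements are determined by their action on words of length `m ≥ 1` and by the restrictions
there. -/
theorem eq_of_smul_eq_of_length_le {m : ℕ} {g h : G}
    (h1 : ∀ v : List X, v.length ≤ m → g • v = h • v)
    (h2 : ∀ v : List X, v.length = m → restrWord g v = restrWord h v) : g = h := by
  refine eq_of_smul_eq_smul (α := List X) fun v => ?_
  rcases le_total v.length m with hv | hv
  · exact h1 v hv
  · rw [← List.take_append_drop m v, smul_append, smul_append, h1 _ (by simp),
      h2 _ (by simpa using hv)]

theorem finite_finitaryOfDepth [Finite X] (D : ℕ) :
    (finitaryOfDepth (G := G) X D : Set G).Finite := by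
  have : Finite {v : List X // v.length ≤ D} := List.finite_length_le X D
  refine Set.Finite.of_injOn (t := Set.univ)
    (f := fun g (v : {v : List X // v.length ≤ D}) =>
      (⟨g • v.1, by rw [length_smul]; exact v.2⟩ : {v : List X // v.length ≤ D}))
    (fun _ _ => Set.mem_univ _) ?_ Set.finite_univ
  intro g hg h hh hgh
  refine eq_of_smul_eq_of_length_le (X := X) (m := D) (fun v hv => ?_) fun v hv => ?_
  · exact congrArg Subtype.val (congrFun hgh ⟨v, hv⟩)
  · rw [hg v hv, hh v hv]

variable (X) in
/-- The elements with a loop labeled by a word of length `m` whose restrictions at all other words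
of length `m` are finitary of depth `D`. -/
def loopElements (G : Type*) [Group G] [MulAction G (List X)] [SelfSimilar G X]
    (m D : ℕ) : Set G :=
  {h | ∃ u : List X, u.length = m ∧ restrWord h u = h ∧
    ∀ w : List X, w.length = m → w ≠ u → restrWord h w ∈ finitaryOfDepth X D}

/-- Along `u` both elements return to themselves, so agreement on a word reduces to agreement on a
word shorter by `m` letters. -/
theorem eq_of_loop {m : ℕ} (hm : m ≠ 0) {g h : G} {u : List X} (hu : u.length = m)
    (hg : restrWord g u = g) (hh : restrWord h u = h)
    (h1 : ∀ v : List X, v.length ≤ m → g • v = h • v)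
    (h2 : ∀ v : List X, v.length = m → v ≠ u → restrWord g v = restrWord h v) : g = h := by
  refine eq_of_smul_eq_smul (α := List X) fun v => ?_
  induction hn : v.length using Nat.strong_induction_on generalizing v with
  | _ n ih =>
    rcases le_total v.length m with hv | hv
    · exact h1 v hv
    · have hl : (v.take m).length = m := by simpa using hv
      rw [← List.take_append_drop m v, smul_append, smul_append, h1 _ hl.le]
      congr 1
      by_cases hvu : v.take m = u
      · rw [hvu, hg, hh]
        exact ih _ (by rw [List.length_drop]; omega) _ rfl
      · rw [h2 _ hl hvu]

theorem finite_loopElements [Finite X] {m : ℕ} (hm : m ≠ 0) (D : ℕ) :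
    (loopElements X G m D).Finite := by
  classical
  have hle : Finite {v : List X // v.length ≤ m} := List.finite_length_le X m
  have heq : {v : List X | v.length = m}.Finite := List.finite_length_eq X m
  have : Finite {v : List X // v.length = m} := heq
  refine (heq.biUnion (t := fun u => {h : G | restrWord h u = h ∧
    ∀ w : List X, w.length = m → w ≠ u → restrWord h w ∈ finitaryOfDepth X D})
    fun u hu => ?_).subset ?_
  · refine Set.Finite.of_injOn
      (t := Set.univ ×ˢ Set.pi Set.univ fun _ => (finitaryOfDepth (G := G) X D : Set G))
      (f := fun g => (fun v : {v : List X // v.length ≤ m} =>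
          (⟨g • v.1, by rw [length_smul]; exact v.2⟩ : {v : List X // v.length ≤ m}),
        fun w : {v : List X // v.length = m} => if w.1 = u then 1 else restrWord g w.1))
      ?_ ?_ (Set.finite_univ.prod (Set.Finite.pi fun _ => finite_finitaryOfDepth D))
    · rintro g ⟨-, hg⟩
      refine ⟨Set.mem_univ _, fun w _ => ?_⟩
      dsimp only
      split_ifs with h
      · exact one_mem _
      · exact hg _ w.2 h
    · rintro g ⟨hg, -⟩ h ⟨hh, -⟩ hgh
      rw [Prod.mk.injEq] at hgh
      refine eq_of_loop hm hu hg hh (fun v hv => ?_) fun v hv hvu => ?_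
      · exact congrArg Subtype.val (congrFun hgh.1 ⟨v, hv⟩)
      · simpa [hvu] using congrFun hgh.2 ⟨v, hv⟩
  · rintro h ⟨u, hu, hh⟩
    exact Set.mem_biUnion hu hh

/-- All restrictions of loop elements and of elements of bounded depth form a finite set. -/
theorem finite_restrWord_loopElements [Finite X] {m : ℕ} (hm : m ≠ 0) (D : ℕ) :
    {g : G | ∃ h ∈ loopElements X G m D, ∃ v : List X, restrWord h v = g}.Finite := by
  refine (((finite_loopElements (G := G) (X := X) hm D).image2 restrWord
    (List.finite_length_le X m)).union (finite_finitaryOfDepth (X := X) D)).subset ?_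
  rintro _ ⟨h, hh, v, rfl⟩
  have ⟨u, hu, hloop, hfin⟩ := hh
  -- Turns around the loop can be removed from `v`; once the word leaves the loop, the restriction
  -- is finitary of depth `D`.
  induction hn : v.length using Nat.strong_induction_on generalizing v with
  | _ n ih =>
    rcases le_total v.length m with hv | hv
    · exact Or.inl ⟨h, hh, v, hv, rfl⟩
    · have hl : (v.take m).length = m := by simpa using hv
      rw [← List.take_append_drop m v, restrWord_append]
      by_cases hvu : v.take m = u
      · rw [hvu, hloop]
        exact ih _ (by rw [List.length_drop]; omega) _ rfl
      · exact Or.inr (restrWord_mem_finitaryOfDepth (hfin _ hl hvu) _)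

/-! ### States with a single nonfinitary continuation -/

/-- At long words, the states of a bounded element do not branch into nonfinitary states. -/
theorem IsBoundedElement.eventually_not_branching [Finite X] {g : G} (hg : IsBoundedElement X g) :
    ∃ n₀ : ℕ, ∀ v : List X, n₀ ≤ v.length → ∀ x y : X, ¬ IsFinitary X (restrWord g (v ++ [x])) →
      ¬ IsFinitary X (restrWord g (v ++ [y])) → x = y := by
  obtain ⟨C, hC⟩ := hg
  let A : ℕ → Set (List X) := fun n => {v | v.length = n ∧ ¬ IsFinitary X (restrWord g v)}
  have hfin : ∀ n, (A n).Finite := fun n =>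
    (List.finite_length_eq X n).subset fun v hv => hv.1
  -- Truncation is onto: over a finite alphabet, a state whose one-letter restrictions are all
  -- finitary is itself finitary.
  have himage : ∀ n, List.dropLast '' A (n + 1) = A n := by
    intro n
    ext v
    constructor
    · rintro ⟨w, ⟨hw, hwf⟩, rfl⟩
      refine ⟨by simp [hw], fun h => hwf ?_⟩
      have hne : w ≠ [] := by rintro rfl; simp at hw
      rw [← List.dropLast_append_getLast hne, restrWord_append]
      exact h.restrWord _
    · rintro ⟨hv, hvf⟩
      by_contra hno
      have hall : ∀ x : X, IsFinitary X (restrWord g (v ++ [x])) := by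
        intro x
        by_contra hx
        exact hno ⟨v ++ [x], ⟨by simp [hv], hx⟩, by simp⟩
      obtain ⟨D, hD⟩ := exists_depth (G := G) (X := X)
        (Set.finite_range fun x : X => restrWord g (v ++ [x]))
      refine hvf ⟨D + 1, fun w hw => ?_⟩
      rcases w with _ | ⟨x, w⟩
      · simp at hw
      · have := hD _ ⟨x, rfl⟩ (hall x) w (by simpa using hw)
        rw [← this, ← restrWord_append, ← restrWord_append, List.append_assoc]
        rfl
  have hmono : Monotone fun n => (A n).ncard := monotone_nat_of_le_succ fun n => by
    change (A n).ncard ≤ (A (n + 1)).ncard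
    rw [← himage n]
    exact Set.ncard_image_le (hfin _)
  have hbdd : ∀ n, (A n).ncard ≤ C := by
    intro n
    have hsub : A n ⊆ activeWords X g n := fun v hv =>
      ⟨hv.1, fun h => hv.2 (h ▸ ⟨0, one_mem _⟩)⟩
    have h1 := (Set.encard_le_encard hsub).trans (hC n)
    rw [← (hfin n).cast_ncard_eq] at h1
    exact_mod_cast h1
  -- Monotone bounded cardinalities become constant; from then on truncation is injective, which
  -- excludes branching.
  obtain ⟨n₀, hn₀⟩ : ∃ n₀, ∀ n, n₀ ≤ n → (A n).ncard = (A n₀).ncard := by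
    have hb : (Set.range fun n => (A n).ncard).Finite :=
      (Set.finite_Iic C).subset (by rintro _ ⟨n, rfl⟩; exact hbdd n)
    obtain ⟨_, ⟨n₀, rfl⟩, hmax⟩ := hb.exists_maximal (Set.range_nonempty _)
    exact ⟨n₀, fun n hn => le_antisymm (hmax ⟨n, rfl⟩ (hmono hn)) (hmono hn)⟩
  refine ⟨n₀, fun v hv x y hx hy => ?_⟩
  have hinj : Set.InjOn List.dropLast (A (v.length + 1)) :=
    Set.injOn_of_ncard_image_eq (by rw [himage, hn₀ _ hv, hn₀ (v.length + 1) (by omega)]) (hfin _)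
  have := hinj (x₁ := v ++ [x]) (x₂ := v ++ [y]) ⟨by simp, hx⟩ ⟨by simp, hy⟩ (by simp)
  simpa using this

/-- Every finite set of bounded states, closed under restrictions, has after finitely many steps
the following shape: the finitary states have bounded depth, along words of length `m` there is at
most one nonfinitary continuation, and it returns to the state. -/
theorem exists_loop_period [Finite X] (hb : ∀ g : G, IsBoundedElement X g) {S : Set G}
    (hS : S.Finite) (hcl : ∀ s ∈ S, ∀ x : X, restr s x ∈ S) :
    ∃ n m D : ℕ, m ≠ 0 ∧ ∀ s ∈ S, ∀ v : List X, n ≤ v.length →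
      (IsFinitary X (restrWord s v) → restrWord s v ∈ finitaryOfDepth X D) ∧
      (∀ u : List X, u.length = m → ¬ IsFinitary X (restrWord s (v ++ u)) →
        restrWord s (v ++ u) = restrWord s v) ∧
      (∀ u w : List X, u.length = w.length → ¬ IsFinitary X (restrWord s (v ++ u)) →
        ¬ IsFinitary X (restrWord s (v ++ w)) → u = w) := by
  classical
  obtain ⟨D, hD⟩ := exists_depth (X := X) hS
  obtain ⟨n₀, hn₀⟩ : ∃ n₀ : ℕ, ∀ s ∈ S, ∀ v : List X, n₀ ≤ v.length → ∀ x y : X,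
      ¬ IsFinitary X (restrWord s (v ++ [x])) → ¬ IsFinitary X (restrWord s (v ++ [y])) →
      x = y := by
    choose d hd using fun s : G => (hb s).eventually_not_branching
    exact ⟨hS.toFinset.sup d, fun s hs v hv =>
      hd s v ((Finset.le_sup (f := d) (hS.mem_toFinset.2 hs)).trans hv)⟩
  have : Finite S := hS
  -- the nonfinitary continuation by one letter
  let φ : S → S := fun s => if h : ∃ x : X, ¬ IsFinitary X (restr s.1 x) then
    ⟨restr s.1 h.choose, hcl _ s.2 _⟩ else s
  -- Beyond length `n₀` the nonfinitary letter is unique, so the choice made in `φ` is the only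
  -- possible one.
  have hφ : ∀ s ∈ S, ∀ v : List X, n₀ ≤ v.length → ∀ u : List X,
      ∀ hu : ¬ IsFinitary X (restrWord s (v ++ u)), ∀ hv : restrWord s v ∈ S,
      restrWord s (v ++ u) = (φ^[u.length] ⟨restrWord s v, hv⟩).1 := by
    intro s hs v hv u
    induction u generalizing v with
    | nil => simp
    | cons x u ih =>
      intro hu hvS
      have hcons : v ++ x :: u = (v ++ [x]) ++ u := by simp
      have hx : ¬ IsFinitary X (restrWord s (v ++ [x])) := fun h => hu (by
        rw [hcons, restrWord_append]; exact h.restrWord u)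
      have hφx : φ ⟨restrWord s v, hvS⟩ = ⟨restrWord s (v ++ [x]), restrWord_mem hcl hs _⟩ := by
        have hex : ∃ y : X, ¬ IsFinitary X (restr (restrWord s v) y) :=
          ⟨x, by simpa [restrWord_append] using hx⟩
        have hy : hex.choose = x := by
          refine hn₀ s hs v hv _ _ ?_ hx
          simpa [restrWord_append] using hex.choose_spec
        apply Subtype.ext
        simp only [φ]
        rw [dif_pos hex]
        simp [restrWord_append, hy]
      rw [List.length_cons, Function.iterate_succ_apply, hφx, hcons]
      exact ih (v ++ [x]) (by simp; omega) (by rwa [← hcons]) _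
  -- Pigeonhole among self-maps of the finite set `S` yields one preperiod and one period for all
  -- states at once.
  obtain ⟨i, j, hij, hφij⟩ : ∃ i j : ℕ, i < j ∧ φ^[i] = φ^[j] := by
    obtain ⟨i, j, hne, h⟩ := Finite.exists_ne_map_eq_of_infinite fun n : ℕ => φ^[n]
    rcases lt_or_gt_of_ne hne with h' | h'
    · exact ⟨i, j, h', h⟩
    · exact ⟨j, i, h', h.symm⟩
  have hper : ∀ k, i ≤ k → φ^[k + (j - i)] = φ^[k] := by
    intro k hk
    obtain ⟨l, rfl⟩ := Nat.exists_eq_add_of_le' hk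
    rw [add_assoc, Nat.add_sub_cancel' hij.le, Function.iterate_add, ← hφij,
      ← Function.iterate_add]
  -- The first `n₀` letters end the branching, the next `i` pass the preperiod of `φ`.
  refine ⟨n₀ + i, j - i, D, by omega, fun s hs v hv => ⟨hD _ (restrWord_mem hcl hs v), ?_, ?_⟩⟩
  · intro u hu hf
    have hsplit : v = v.take n₀ ++ v.drop n₀ := (List.take_append_drop _ _).symm
    have hl : (v.take n₀).length = n₀ := by simp; omega
    have hd : i ≤ (v.drop n₀).length := by simp; omega
    have hmem := restrWord_mem hcl hs (v.take n₀)
    have hvf : ¬ IsFinitary X (restrWord s v) := fun h => hf (by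
      rw [restrWord_append]; exact h.restrWord u)
    generalize v.take n₀ = a at *
    generalize v.drop n₀ = b at *
    subst hsplit
    rw [hφ s hs a hl.ge b hvf hmem]
    rw [List.append_assoc] at hf ⊢
    rw [hφ s hs a hl.ge _ hf hmem, List.length_append, hu, hper _ hd]
  · intro u w huw hu hw
    induction u generalizing v w with
    | nil => exact (List.length_eq_zero_iff.1 huw.symm).symm
    | cons x u ih =>
      rcases w with _ | ⟨y, w⟩
      · simp at huw
      · have h1 : ∀ (z : X) (r : List X), v ++ z :: r = (v ++ [z]) ++ r := by simp
        rw [h1] at hu hw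
        obtain rfl : x = y := hn₀ s hs v (by omega) x y
          (fun h => hu (by rw [restrWord_append]; exact h.restrWord u))
          (fun h => hw (by rw [restrWord_append]; exact h.restrWord w))
        rw [ih (v ++ [x]) (by simp; omega) w (by simpa using huw) hu hw]

end Contracting

/-! ### Products of states and contraction -/

section ListRestriction

variable {G X : Type*} [Group G] [MulAction G (List X)] [SelfSimilar G X]

/-- The restrictions of the factors of a product of group elements at a word. -/
noncomputable def restrList : List G → List X → List G
  | [], _ => []
  | s :: l, v => restrWord s (l.prod • v) :: restrList l v

theorem prod_restrList (l : List G) (v : List X) :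
    (restrList l v).prod = restrWord l.prod v := by
  induction l with
  | nil => simp [restrList]
  | cons s l ih => simp [restrList, restrWord_mul, ih]

variable (X) in
open Classical in
/-- The number of factors that are not finitary. -/
noncomputable def nonfinitaryCount (l : List G) : ℕ := l.countP fun s => ¬ IsFinitary X s

theorem nonfinitaryCount_restrList_le (l : List G) (v : List X) :
    nonfinitaryCount X (restrList l v) ≤ nonfinitaryCount X l := by
  classical
  induction l with
  | nil => exact le_rfl
  | cons s l ih =>
    simp only [nonfinitaryCount, restrList, List.countP_cons] at ih ⊢
    refine add_le_add ih ?_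
    split_ifs with h1 h2
    · exact le_rfl
    · simp only [decide_not, Bool.not_eq_true', decide_eq_false_iff_not, not_not] at h1 h2
      exact absurd (h2.restrWord _) h1
    · simp
    · exact le_rfl

/-- A product in which the number of nonfinitary factors is preserved along a loop. -/
theorem loop_of_nonfinitaryCount_eq {S : Set G} {m D : ℕ}
    (h1 : ∀ s ∈ S, ∀ v : List X, IsFinitary X (restrWord s v) →
      restrWord s v ∈ finitaryOfDepth X D)
    (h2 : ∀ s ∈ S, ∀ v u : List X, u.length = m → ¬ IsFinitary X (restrWord s (v ++ u)) →
        restrWord s (v ++ u) = restrWord s v)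
    (h3 : ∀ s ∈ S, ∀ v u w : List X, u.length = w.length →
      ¬ IsFinitary X (restrWord s (v ++ u)) → ¬ IsFinitary X (restrWord s (v ++ w)) → u = w)
    (l : List G) (hl : ∀ s ∈ l, s ∈ S) {v u : List X} (hv : v.length = D) (hu : u.length = m)
    (hc : nonfinitaryCount X (restrList l (v ++ u)) = nonfinitaryCount X l) :
    restrWord l.prod (v ++ u) = restrWord l.prod v ∧ ∀ w : List X, w.length = m → w ≠ u →
      restrWord l.prod (v ++ w) ∈ finitaryOfDepth X D := by
  classical
  induction l with
  | nil => simp [one_mem]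
  | cons s l ih =>
    have hsS := hl s (by simp)
    have hle := nonfinitaryCount_restrList_le l (v ++ u)
    simp only [nonfinitaryCount, restrList, List.countP_cons] at hc hle ih
    -- Equality of the counts forbids a nonfinitary factor from becoming finitary.
    have hs : IsFinitary X s ∨ ¬ IsFinitary X (restrWord s (l.prod • (v ++ u))) := by
      by_contra! hcon
      simp [hcon.1, hcon.2] at hc hle
      omega
    have hcl : nonfinitaryCount X (restrList l (v ++ u)) = nonfinitaryCount X l := by
      simp only [nonfinitaryCount]
      rcases hs with hs | hs
      · simpa [hs, hs.restrWord] using hc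
      · have : ¬ IsFinitary X s := fun h => hs (h.restrWord _)
        simpa [hs, this] using hc
    obtain ⟨ih1, ih2⟩ := ih (fun s hs => hl s (by simp [hs])) hcl
    simp only [List.prod_cons, restrWord_mul, ih1]
    rw [smul_append] at hs
    constructor
    · rw [smul_append]
      congr 1
      -- A finitary factor has died after the `D` letters of `v`; a nonfinitary one has returned to
      -- its state after `u`.
      rcases hs with hs | hs
      · rw [restrWord_append, show restrWord s (l.prod • v) = 1 from
          h1 s hsS [] hs _ (by rw [length_smul, hv]), restrWord_one]
      · exact h2 s hsS _ _ (by rw [length_smul, hu]) hs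
    · intro w hw hwu
      refine mul_mem ?_ (ih2 w hw hwu)
      refine h1 s hsS _ ?_
      rw [smul_append]
      rcases hs with hs | hs
      · exact hs.restrWord _
      · by_contra hnf
        have := h3 s hsS _ _ _ (by simp [length_smul, hw, hu]) hnf hs
        exact hwu (MulAction.injective _ this)

theorem restrList_mem {S : Set G} (hcl : ∀ s ∈ S, ∀ x : X, restr s x ∈ S) {l : List G}
    (hl : ∀ s ∈ l, s ∈ S) (v : List X) : ∀ s ∈ restrList l v, s ∈ S := by
  induction l with
  | nil => simp [restrList]
  | cons s l ih =>
    simp only [restrList, List.mem_cons, forall_eq_or_imp] at hl ⊢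
    exact ⟨restrWord_mem hcl hl.1 _, ih hl.2⟩

theorem exists_mem_restrList {l : List G} {v : List X} {r : G} (hr : r ∈ restrList l v) :
    ∃ s ∈ l, ∃ w : List X, w.length = v.length ∧ r = restrWord s w := by
  induction l with
  | nil => simp [restrList] at hr
  | cons s l ih =>
    rcases List.mem_cons.1 hr with rfl | hr
    · exact ⟨s, by simp, _, length_smul _ _, rfl⟩
    · obtain ⟨s', hs', h⟩ := ih hr
      exact ⟨s', by simp [hs'], h⟩

/-- Groups generated by bounded automata are contracting. -/
theorem GeneratedByBoundedAutomaton.exists_isContractingSet [Finite X]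
    (hG : GeneratedByBoundedAutomaton G X) : ∃ N : Set G, IsContractingSet G X N := by
  obtain ⟨S, hS, hcl, hgen⟩ := hG.exists_generating_states
  obtain ⟨n, m, D, hm, hloop⟩ := exists_loop_period hG.isBoundedElement hS hcl
  -- States reached after `n` letters satisfy the loop properties at all words, without a length
  -- condition.
  let S' : Set G := {r | ∃ s ∈ S, ∃ v : List X, n ≤ v.length ∧ restrWord s v = r}
  have hcl' : ∀ r ∈ S', ∀ x : X, restr r x ∈ S' := by
    rintro _ ⟨s, hs, v, hv, rfl⟩ x
    exact ⟨s, hs, v ++ [x], by simp; omega, by simp [restrWord_append]⟩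
  have h1 : ∀ r ∈ S', ∀ v : List X, IsFinitary X (restrWord r v) →
      restrWord r v ∈ finitaryOfDepth X D := by
    rintro _ ⟨s, hs, v, hv, rfl⟩ w
    rw [← restrWord_append]
    exact (hloop s hs _ (by simp; omega)).1
  have h2 : ∀ r ∈ S', ∀ v u : List X, u.length = m → ¬ IsFinitary X (restrWord r (v ++ u)) →
      restrWord r (v ++ u) = restrWord r v := by
    rintro _ ⟨s, hs, v, hv, rfl⟩ w u
    simp only [← restrWord_append, ← List.append_assoc]
    exact (hloop s hs _ (by simp; omega)).2.1 u
  have h3 : ∀ r ∈ S', ∀ v u w : List X, u.length = w.length →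
      ¬ IsFinitary X (restrWord r (v ++ u)) → ¬ IsFinitary X (restrWord r (v ++ w)) →
      u = w := by
    rintro _ ⟨s, hs, v, hv, rfl⟩ v' u w
    simp only [← restrWord_append, ← List.append_assoc]
    exact (hloop s hs _ (by simp; omega)).2.2 u w
  -- Each block of `D + m` letters either lowers the number of nonfinitary factors, which happens at
  -- most `k` times, or exhibits a loop element.
  have key : ∀ k (l : List G), (∀ s ∈ l, s ∈ S') → nonfinitaryCount X l ≤ k →
      ∀ v : List X, (k + 1) * (D + m) ≤ v.length → restrWord l.prod v ∈
        {g : G | ∃ h ∈ loopElements X G m D, ∃ v : List X, restrWord h v = g} := by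
    intro k
    induction k using Nat.strong_induction_on with
    | _ k ih =>
      intro l hl hk v hv
      have hexp : (k + 1) * (D + m) = k * (D + m) + (D + m) := by ring
      rcases (nonfinitaryCount_restrList_le l (v.take (D + m))).lt_or_eq with hlt | heq
      · rw [← List.take_append_drop (D + m) v, restrWord_append, ← prod_restrList]
        obtain ⟨j, rfl⟩ : ∃ j, k = j + 1 := Nat.exists_eq_succ_of_ne_zero (by omega)
        exact ih j (by omega) _ (restrList_mem hcl' hl _) (by omega) _
          (by rw [List.length_drop]; omega)
      · have hsplit : v.take (D + m) = v.take D ++ (v.drop D).take m := List.take_add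
        rw [hsplit] at heq
        have hu : ((v.drop D).take m).length = m := by simp; omega
        obtain ⟨h4, h5⟩ := loop_of_nonfinitaryCount_eq h1 h2 h3 l hl (by simp; omega) hu heq
        refine ⟨restrWord l.prod (v.take D), ⟨_, hu, ?_, fun w hw hwu => ?_⟩, v.drop D, ?_⟩
        · rw [← restrWord_append, h4]
        · rw [← restrWord_append]
          exact h5 w hw hwu
        · rw [← restrWord_append, List.take_append_drop]
  refine ⟨_, finite_restrWord_loopElements (G := G) (X := X) hm D, fun g => ?_⟩
  obtain ⟨l, hl, rfl⟩ := hgen g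
  refine ⟨n + (nonfinitaryCount X l + 1) * (D + m), fun v hv => ?_⟩
  rw [← List.take_append_drop n v, restrWord_append, ← prod_restrList]
  have hln : (v.take n).length = n := by simp; omega
  refine key _ _ (fun r hr => ?_) (nonfinitaryCount_restrList_le _ _) _ (by simp; omega)
  obtain ⟨s, hs, w, hw, rfl⟩ := exists_mem_restrList hr
  exact ⟨s, hl s hs, w, by omega, rfl⟩

end ListRestriction

/-! ### Left-infinite sequences -/

section LeftSeq

variable {X : Type*}

theorem lastWord_inj {ξ η : LeftSeq X} {n : ℕ} :
    lastWord ξ n = lastWord η n ↔ ∀ i < n, ξ i = η i := by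
  induction n with
  | zero => simp [lastWord]
  | succ n ih =>
    simp only [lastWord, List.cons.injEq, ih, Nat.lt_succ_iff_lt_or_eq]
    constructor
    · rintro ⟨h1, h2⟩ i (hi | rfl)
      · exact h2 i hi
      · exact h1
    · exact fun h => ⟨h n (Or.inr rfl), fun i hi => h i (Or.inl hi)⟩

theorem LeftSeq.ext_lastWord {ξ η : LeftSeq X} (h : ∀ n, lastWord ξ n = lastWord η n) : ξ = η :=
  funext fun i => lastWord_inj.1 (h (i + 1)) i (Nat.lt_succ_self i)

theorem lastWord_eq_of_le {ξ η : LeftSeq X} {m n : ℕ} (hmn : m ≤ n)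
    (h : lastWord ξ n = lastWord η n) : lastWord ξ m = lastWord η m :=
  lastWord_inj.2 fun i hi => lastWord_inj.1 h i (hi.trans_le hmn)

/-- The sequence with the last `n` letters deleted. -/
def LeftSeq.shift (n : ℕ) (ξ : LeftSeq X) : LeftSeq X := fun i => ξ (i + n)

/-- The sequence `ξ x`. -/
def LeftSeq.snoc (ξ : LeftSeq X) (x : X) : LeftSeq X := fun i => Nat.casesOn i x ξ

/-- The sequence `ξ v`. -/
def LeftSeq.append : LeftSeq X → List X → LeftSeq X
  | ξ, [] => ξ
  | ξ, x :: v => (ξ.snoc x).append v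

theorem lastWord_snoc (ξ : LeftSeq X) (x : X) (n : ℕ) :
    lastWord (ξ.snoc x) (n + 1) = lastWord ξ n ++ [x] := by
  induction n with
  | zero => rfl
  | succ n ih => rw [lastWord, ih]; rfl

theorem lastWord_append (ξ : LeftSeq X) (v : List X) (n : ℕ) :
    lastWord (ξ.append v) (v.length + n) = lastWord ξ n ++ v := by
  induction v generalizing ξ n with
  | nil => simp [LeftSeq.append]
  | cons x v ih =>
    rw [List.length_cons, add_right_comm, add_assoc, LeftSeq.append, ih, lastWord_snoc]
    simp

theorem lastWord_append_length (ξ : LeftSeq X) (v : List X) :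
    lastWord (ξ.append v) v.length = v := by
  simpa [lastWord] using lastWord_append ξ v 0

theorem lastWord_add (ξ : LeftSeq X) (m n : ℕ) :
    lastWord ξ (m + n) = lastWord (ξ.shift m) n ++ lastWord ξ m := by
  induction n with
  | zero => simp [lastWord]
  | succ n ih =>
    rw [← add_assoc, lastWord, ih, lastWord, List.cons_append, LeftSeq.shift, add_comm n m]

theorem append_shift (ξ : LeftSeq X) (n : ℕ) : (ξ.shift n).append (lastWord ξ n) = ξ := by
  have h : ∀ k, lastWord ((ξ.shift n).append (lastWord ξ n)) (n + k) = lastWord ξ (n + k) := by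
    intro k
    rw [lastWord_add ξ]
    conv_lhs => rw [← length_lastWord ξ n]
    rw [length_lastWord ξ n]
    have := lastWord_append (ξ.shift n) (lastWord ξ n) k
    rwa [length_lastWord] at this
  exact LeftSeq.ext_lastWord fun k => lastWord_eq_of_le (Nat.le_add_left k n) (h k)

theorem append_injective (v : List X) : Function.Injective fun ξ : LeftSeq X => ξ.append v := by
  intro ξ η h
  refine LeftSeq.ext_lastWord fun n => ?_
  have h1 := lastWord_append ξ v n
  have h2 := lastWord_append η v n
  simp only at h
  rw [h, h2] at h1
  exact (List.append_cancel_right h1).symm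

/-- A set of sequences is finite if the numbers of its last words of length `n` are bounded. -/
theorem finite_of_lastWord_bounded {A : Set (LeftSeq X)} {C : ℕ}
    (h : ∀ n, ((fun ξ => lastWord ξ n) '' A).encard ≤ C) : A.Finite := by
  by_contra hA
  obtain ⟨F, hFA, hF⟩ := Set.Infinite.exists_subset_card_eq hA (C + 1)
  -- Equal pairs need no separation; with the implication inside, `d` is defined on all pairs and
  -- has a finite supremum.
  have hsep : ∀ p : LeftSeq X × LeftSeq X, ∃ n, p.1 ≠ p.2 → lastWord p.1 n ≠ lastWord p.2 n := by
    intro p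
    by_contra! hno
    exact (hno 0).1 (LeftSeq.ext_lastWord fun n => (hno n).2)
  choose d hd using hsep
  let n := (F ×ˢ F).sup d
  have hinj : Set.InjOn (fun ξ => lastWord ξ n) (F : Set (LeftSeq X)) := by
    intro ξ hξ η hη heq
    by_contra hne
    exact hd (ξ, η) hne (lastWord_eq_of_le (Finset.le_sup (f := d)
      (Finset.mk_mem_product hξ hη)) heq)
  have h1 := (Set.encard_le_encard (Set.image_mono hFA)).trans (h n)
  rw [hinj.encard_image, Set.encard_coe_eq_coe_finsetCard, hF] at h1
  have h2 : C + 1 ≤ C := by exact_mod_cast h1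
  omega

instance [Nontrivial X] : Infinite (LeftSeq X) := inferInstanceAs (Infinite (ℕ → X))

end LeftSeq

/-! ### The nucleus, asymptotic equivalence and the post-critical set -/

section Nucleus

variable {G X : Type*} [Group G] [MulAction G (List X)] [SelfSimilar G X]

theorem exists_length_eq [Nonempty X] (n : ℕ) : ∃ v : List X, v.length = n :=
  ⟨List.replicate n (Classical.arbitrary X), by simp⟩

variable (hN : ∃ N : Set G, IsContractingSet G X N)
include hN

theorem isContractingSet_nucleus : IsContractingSet G X (nucleus G X) :=
  (isLeast_nucleus G X hN).1

theorem one_mem_nucleus [Nonempty X] : (1 : G) ∈ nucleus G X := by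
  obtain ⟨n, hn⟩ := (isContractingSet_nucleus hN).2 1
  obtain ⟨v, hv⟩ := exists_length_eq (X := X) n
  simpa using hn v hv.ge

/-- By minimality: the nucleus elements with all restrictions in the nucleus already form a
contracting set. -/
theorem restrWord_mem_nucleus {g : G} (hg : g ∈ nucleus G X) (v : List X) :
    restrWord g v ∈ nucleus G X := by
  have hc := isContractingSet_nucleus hN
  have : IsContractingSet G X {g ∈ nucleus G X | ∀ v : List X, restrWord g v ∈ nucleus G X} := by
    refine ⟨hc.1.subset fun g hg => hg.1, fun g => ?_⟩
    obtain ⟨n, hn⟩ := hc.2 g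
    exact ⟨n, fun v hv => ⟨hn v hv, fun w => by
      rw [← restrWord_append]; exact hn _ (by simp; omega)⟩⟩
  exact ((isLeast_nucleus G X hN).2 this hg).2 v

theorem inv_mem_nucleus {g : G} (hg : g ∈ nucleus G X) : g⁻¹ ∈ nucleus G X := by
  have hc := isContractingSet_nucleus hN
  have : IsContractingSet G X (nucleus G X)⁻¹ := by
    refine ⟨hc.1.inv, fun g => ?_⟩
    obtain ⟨n, hn⟩ := hc.2 g⁻¹
    refine ⟨n, fun v hv => ?_⟩
    rw [Set.mem_inv, ← restrWord_inv]
    exact hn _ (by rwa [length_smul])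
  exact (isLeast_nucleus G X hN).2 this hg

/-- Again by minimality. Every state of the nucleus has an incoming arrow, hence is the end of a
left-infinite path. -/
theorem exists_restr_eq_of_mem_nucleus {g : G} (hg : g ∈ nucleus G X) :
    ∃ h ∈ nucleus G X, ∃ x : X, restr h x = g := by
  have hc := isContractingSet_nucleus hN
  have : IsContractingSet G X {g | ∃ h ∈ nucleus G X, ∃ x : X, restr h x = g} := by
    refine ⟨hc.1.subset ?_, fun g => ?_⟩
    · rintro _ ⟨h, hh, x, rfl⟩
      exact restrWord_mem_nucleus hN hh [x]
    · obtain ⟨n, hn⟩ := hc.2 g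
      refine ⟨n + 1, fun v hv => ?_⟩
      have hne : v ≠ [] := by rintro rfl; simp at hv
      rw [← List.dropLast_append_getLast hne, restrWord_append]
      exact ⟨_, hn _ (by simp; omega), _, rfl⟩
  exact (isLeast_nucleus G X hN).2 this hg

omit hN in
theorem IsLeftPath.smul_lastWord {A : Set G} {s : ℕ → G} {ξ η : LeftSeq X}
    (h : IsLeftPath A s ξ η) (n : ℕ) :
    s n • lastWord ξ n = lastWord η n ∧ restrWord (s n) (lastWord ξ n) = s 0 := by
  induction n with
  | zero => exact ⟨smul_nil _, rfl⟩
  | succ n ih =>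
    obtain ⟨h1, h2⟩ := h.2 n
    rw [lastWord, lastWord, smul_cons, restrWord_cons, h1, h2]
    exact ⟨by rw [ih.1], ih.2⟩

omit hN in
theorem IsLeftPath.shift {A : Set G} {s : ℕ → G} {ξ η : LeftSeq X} (h : IsLeftPath A s ξ η)
    (k : ℕ) : IsLeftPath A (fun n => s (n + k)) (ξ.shift k) (η.shift k) := by
  refine ⟨fun n => h.1 _, fun n => ?_⟩
  have := h.2 (n + k)
  rw [add_right_comm] at this
  exact this

/-- Each state is the restriction of an earlier state at an arbitrarily long word, and finiteness of
`A` makes the required length uniform. This lets paths be multiplied without leaving the nucleus. -/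
theorem IsLeftPath.mem_nucleus {A : Set G} (hA : A.Finite) {s : ℕ → G} {ξ η : LeftSeq X}
    (h : IsLeftPath A s ξ η) : IsLeftPath (nucleus G X) s ξ η := by
  refine ⟨fun k => ?_, h.2⟩
  choose d hd using (isContractingSet_nucleus hN).2
  have h1 := ((h.shift k).smul_lastWord (hA.toFinset.sup d)).2
  simp only [zero_add] at h1
  rw [← h1]
  refine hd _ _ ?_
  rw [length_lastWord]
  exact Finset.le_sup (f := d) (hA.mem_toFinset.2 (h.1 _))

omit hN in
/-- Some left-infinite path in the nucleus ends in `g` and is labeled by `ξ | η`. -/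
def Linked (g : G) (ξ η : LeftSeq X) : Prop :=
  ∃ s : ℕ → G, IsLeftPath (nucleus G X) s ξ η ∧ s 0 = g

omit hN in
theorem asympRel_iff {p q : LeftSeq X × G} :
    asympRel G X p q ↔ Linked (q.2 * p.2⁻¹) p.1 q.1 := Iff.rfl

theorem Linked.refl [Nonempty X] (ξ : LeftSeq X) : Linked (1 : G) ξ ξ :=
  ⟨fun _ => 1, ⟨fun _ => one_mem_nucleus hN, fun _ => by simp⟩, rfl⟩

theorem Linked.symm {g : G} {ξ η : LeftSeq X} (h : Linked g ξ η) : Linked g⁻¹ η ξ := by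
  obtain ⟨s, hs, rfl⟩ := h
  refine ⟨fun n => (s n)⁻¹, ⟨fun n => inv_mem_nucleus hN (hs.1 n), fun n => ?_⟩, rfl⟩
  obtain ⟨h1, h2⟩ := hs.2 n
  rw [← h1, onLetter_inv_onLetter, restr_inv, h2]
  exact ⟨rfl, rfl⟩

theorem Linked.trans {g h : G} {ξ η ζ : LeftSeq X} (h1 : Linked g ξ η) (h2 : Linked h η ζ) :
    Linked (h * g) ξ ζ := by
  obtain ⟨s, hs, rfl⟩ := h1
  obtain ⟨r, hr, rfl⟩ := h2
  have hf := (isContractingSet_nucleus hN).1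
  refine ⟨fun n => r n * s n, IsLeftPath.mem_nucleus hN (hf.mul hf)
    ⟨fun n => Set.mul_mem_mul (hr.1 n) (hs.1 n), fun n => ?_⟩, rfl⟩
  rw [onLetter_mul, restr_mul, (hs.2 n).1, (hs.2 n).2, (hr.2 n).1, (hr.2 n).2]
  exact ⟨rfl, rfl⟩

omit hN in
theorem Linked.mem_nucleus {g : G} {ξ η : LeftSeq X} (h : Linked g ξ η) : g ∈ nucleus G X := by
  obtain ⟨s, hs, rfl⟩ := h
  exact hs.1 0

omit hN in
theorem Linked.exists_shift {g : G} {ξ η : LeftSeq X} (h : Linked g ξ η) (n : ℕ) :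
    ∃ r : G, Linked r (ξ.shift n) (η.shift n) ∧ r • lastWord ξ n = lastWord η n ∧
      restrWord r (lastWord ξ n) = g := by
  obtain ⟨s, hs, rfl⟩ := h
  exact ⟨s n, ⟨_, hs.shift n, by simp⟩, hs.smul_lastWord n⟩

theorem Linked.append {g : G} {ξ η : LeftSeq X} (h : Linked g ξ η) (v : List X) :
    Linked (restrWord g v) (ξ.append v) (η.append (g • v)) := by
  induction v generalizing g ξ η with
  | nil => rwa [smul_nil]
  | cons x v ih =>
    rw [smul_cons]
    refine ih ?_
    obtain ⟨s, hs, rfl⟩ := h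
    refine ⟨fun n => Nat.casesOn n (restr (s 0) x) s, ⟨?_, ?_⟩, rfl⟩
    · rintro (_ | n)
      · exact restrWord_mem_nucleus hN (hs.1 0) [x]
      · exact hs.1 n
    · rintro (_ | n)
      · exact ⟨rfl, rfl⟩
      · exact hs.2 n

theorem exists_linked_of_mem_nucleus {g : G} (hg : g ∈ nucleus G X) :
    ∃ ξ η : LeftSeq X, Linked g ξ η := by
  choose f hf x hx using fun h : nucleus G X => exists_restr_eq_of_mem_nucleus hN h.2
  let s : ℕ → nucleus G X := fun n => Nat.rec ⟨g, hg⟩ (fun _ h => ⟨f h, hf h⟩) n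
  exact ⟨fun n => x (s n), fun n => onLetter (s (n + 1)).1 (x (s n)), fun n => (s n).1,
    ⟨fun n => (s n).2, fun n => ⟨rfl, hx (s n)⟩⟩, rfl⟩

omit hN in
-- A path that reaches 1 stays there, so avoiding 1 only has to be checked at the end state.
theorem mem_postCritical_iff {ξ : LeftSeq X} :
    ξ ∈ postCritical G X ↔ ∃ (g : G) (η : LeftSeq X), g ≠ 1 ∧ Linked g ξ η := by
  constructor
  · rintro ⟨s, η, hs⟩
    exact ⟨s 0, η, (hs.1 0).2, s, ⟨fun n => (hs.1 n).1, hs.2⟩, rfl⟩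
  · rintro ⟨g, η, hg, s, hs, rfl⟩
    refine ⟨s, η, fun n => ⟨hs.1 n, fun h => hg ?_⟩, hs.2⟩
    rw [← (hs.smul_lastWord n).2, show s n = 1 from h, restrWord_one]

/-- The post-critical set is a union of classes of the asymptotic equivalence relation. -/
theorem mem_postCritical_of_linked {ξ η : LeftSeq X} (h : Linked (1 : G) η ξ)
    (hξ : ξ ∈ postCritical G X) : η ∈ postCritical G X := by
  rw [mem_postCritical_iff] at hξ ⊢
  obtain ⟨g, ζ, hg, hl⟩ := hξ
  exact ⟨g * 1, ζ, by simpa using hg, h.trans hN hl⟩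

/-- The last `n` letters of `η` are the image of those of `ξ` under a nucleus element, leaving at
most as many words as the nucleus has elements. -/
theorem finite_linked (ξ : LeftSeq X) : {η : LeftSeq X | ∃ g : G, Linked g ξ η}.Finite := by
  have hf := (isContractingSet_nucleus hN).1
  refine finite_of_lastWord_bounded (C := (nucleus G X).ncard) fun n => ?_
  rw [hf.cast_ncard_eq]
  refine (Set.encard_le_encard (t := (fun g => g • lastWord ξ n) '' nucleus G X) ?_).trans
    (Set.encard_image_le _ _)
  rintro _ ⟨η, ⟨g, hg⟩, rfl⟩
  obtain ⟨r, hr, h1, -⟩ := hg.exists_shift n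
  exact ⟨r, hr.mem_nucleus, h1⟩

/-- The last `n` letters of a post-critical sequence are an active word of some nucleus element, and
there are boundedly many of these. -/
theorem finite_postCritical (hb : ∀ g : G, IsBoundedElement X g) : (postCritical G X).Finite := by
  choose C hC using hb
  have hf := (isContractingSet_nucleus hN).1
  refine finite_of_lastWord_bounded (C := ∑ g ∈ hf.toFinset, C g) fun n => ?_
  have hsub : (fun ξ => lastWord ξ n) '' postCritical G X ⊆
      ⋃ g ∈ hf.toFinset, activeWords X g n := by
    rintro _ ⟨ξ, hξ, rfl⟩
    obtain ⟨g, η, hg, hl⟩ := mem_postCritical_iff.1 hξ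
    obtain ⟨r, hr, -, h2⟩ := hl.exists_shift n
    simp only [Set.mem_iUnion]
    exact ⟨r, hf.mem_toFinset.2 hr.mem_nucleus, length_lastWord _ _, by rwa [h2]⟩
  refine (Set.encard_le_encard hsub).trans ((Finset.set_encard_biUnion_le _ _).trans ?_)
  push_cast
  exact Finset.sum_le_sum fun g _ => hC g n

end Nucleus

/-! ### Topology of the space of sequences -/

section LeftSeqTopology

variable {X : Type*}

theorem continuous_letter (i : ℕ) :
    @Continuous (LeftSeq X) X _ ⊥ fun ξ => ξ i :=
  let : TopologicalSpace X := ⊥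
  continuous_apply (A := fun _ : ℕ => X) i

theorem continuous_leftSeq {Y : Type*} [TopologicalSpace Y] {f : Y → LeftSeq X}
    (h : ∀ i, @Continuous Y X _ ⊥ fun y => f y i) : Continuous f :=
  let : TopologicalSpace X := ⊥
  continuous_pi (A := fun _ : ℕ => X) h

instance [Finite X] : CompactSpace (LeftSeq X) :=
  let : TopologicalSpace X := ⊥
  inferInstanceAs (CompactSpace (ℕ → X))

instance : T2Space (LeftSeq X) :=
  let : TopologicalSpace X := ⊥
  have : DiscreteTopology X := ⟨rfl⟩
  inferInstanceAs (T2Space (ℕ → X))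

theorem continuous_append (v : List X) : Continuous fun ξ : LeftSeq X => ξ.append v := by
  induction v with
  | nil => exact continuous_id
  | cons x v ih =>
    refine ih.comp (continuous_leftSeq fun i => ?_)
    rcases i with _ | i
    · exact @continuous_const _ _ _ ⊥ x
    · exact continuous_letter i

theorem isClosed_lastWord_eq (n : ℕ) (v : List X) :
    IsClosed {ξ : LeftSeq X | lastWord ξ n = v} := by
  induction n generalizing v with
  | zero => exact isClosed_const (p := [] = v)
  | succ n ih =>
    rcases v with _ | ⟨x, v⟩
    · simp [lastWord]
    · simp only [lastWord, List.cons.injEq]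
      let : TopologicalSpace X := ⊥
      have : DiscreteTopology X := ⟨rfl⟩
      exact (isClosed_eq (continuous_letter n) continuous_const).inter (ih v)

end LeftSeqTopology

/-! ### Topology of the tile and of its level tiles -/

section TileTopology

variable {G X : Type*} [Group G] [MulAction G (List X)] [SelfSimilar G X]

/-- By compactness, the sequences linked to a closed set form a closed set. -/
theorem isClosed_setOf_linked [Finite X] (hN : ∃ N : Set G, IsContractingSet G X N)
    {C : Set (LeftSeq X)} (hC : IsClosed C) (g : G) :
    IsClosed {η : LeftSeq X | ∃ ξ ∈ C, Linked g ξ η} := by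
  let : TopologicalSpace X := ⊥
  have : DiscreteTopology X := ⟨rfl⟩
  let : TopologicalSpace G := ⊥
  have : DiscreteTopology G := ⟨rfl⟩
  have hfin := (isContractingSet_nucleus hN).1
  have : Finite (nucleus G X) := hfin
  let Z := (ℕ → nucleus G X) × LeftSeq X × LeftSeq X
  -- The space of labeled paths starting from `C` and ending in `g` is compact; the set in question
  -- is its projection.
  let K : Set Z := {p | p.2.1 ∈ C ∧ (p.1 0).1 = g ∧ ∀ n,
    onLetter (p.1 (n + 1)).1 (p.2.1 n) = p.2.2 n ∧ restr (p.1 (n + 1)).1 (p.2.1 n) = (p.1 n).1}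
  have hstate : ∀ n, Continuous fun p : Z => (p.1 n).1 := fun n =>
    continuous_subtype_val.comp ((continuous_apply n).comp continuous_fst)
  have hin : ∀ n, Continuous fun p : Z => p.2.1 n := fun n =>
    (continuous_letter n).comp (continuous_fst.comp continuous_snd)
  have hout : ∀ n, Continuous fun p : Z => p.2.2 n := fun n =>
    (continuous_letter n).comp (continuous_snd.comp continuous_snd)
  have hK : IsClosed K := by
    have hall : IsClosed (⋂ n, {p : Z | onLetter (p.1 (n + 1)).1 (p.2.1 n) = p.2.2 n} ∩
        {p : Z | restr (p.1 (n + 1)).1 (p.2.1 n) = (p.1 n).1}) := by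
      refine isClosed_iInter fun n => (isClosed_eq ?_ (hout n)).inter (isClosed_eq ?_ (hstate n))
      · exact (continuous_of_discreteTopology (f := fun q : G × X => onLetter q.1 q.2)).comp
          ((hstate (n + 1)).prodMk (hin n))
      · exact (continuous_of_discreteTopology (f := fun q : G × X => restr q.1 q.2)).comp
          ((hstate (n + 1)).prodMk (hin n))
    convert (hC.preimage (continuous_fst.comp continuous_snd : Continuous fun p : Z => p.2.1)).inter
      ((isClosed_eq (hstate 0) (continuous_const (y := g))).inter hall) using 1
    ext p
    refine and_congr_right fun _ => and_congr_right fun _ => ?_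
    rw [Set.mem_iInter]
    rfl
  have himage : {η : LeftSeq X | ∃ ξ ∈ C, Linked g ξ η} = (fun p : Z => p.2.2) '' K := by
    ext η
    constructor
    · rintro ⟨ξ, hξ, s, hs, h0⟩
      exact ⟨(fun n => ⟨s n, hs.1 n⟩, ξ, η), ⟨hξ, h0, hs.2⟩, rfl⟩
    · rintro ⟨⟨s, ξ, η⟩, ⟨hξ, h0, hs⟩, rfl⟩
      exact ⟨ξ, hξ, fun n => (s n).1, ⟨fun n => (s n).2, hs⟩, h0⟩
  rw [himage]
  exact (hK.isCompact.image (continuous_snd.comp continuous_snd)).isClosed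

theorem continuous_point : Continuous (point G : LeftSeq X → Tile G X) := by
  let : TopologicalSpace G := ⊥
  refine Continuous.subtype_mk ?_ _
  exact (continuous_coinduced_rng (f := Quot.mk (asympRel G X))).comp
    (continuous_id.prodMk continuous_const)

theorem surjective_point : Function.Surjective (point G : LeftSeq X → Tile G X) := by
  rintro ⟨_, ξ, rfl⟩
  exact ⟨ξ, rfl⟩

variable (hN : ∃ N : Set G, IsContractingSet G X N)
include hN

theorem equivalence_asympRel [Nonempty X] : Equivalence (asympRel G X) where
  refl p := by
    rw [asympRel_iff, mul_inv_cancel]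
    exact Linked.refl hN _
  symm {p q} h := by
    rw [asympRel_iff] at h ⊢
    simpa using h.symm hN
  trans {p q r} h1 h2 := by
    rw [asympRel_iff] at h1 h2 ⊢
    simpa using h1.trans hN h2

theorem mk_eq_mk_iff [Nonempty X] {p q : LeftSeq X × G} :
    Quot.mk (asympRel G X) p = Quot.mk (asympRel G X) q ↔ Linked (q.2 * p.2⁻¹) p.1 q.1 := by
  rw [(equivalence_asympRel hN).quot_mk_eq_iff, asympRel_iff]

theorem point_eq_point_iff [Nonempty X] {ξ η : LeftSeq X} :
    point G ξ = point G η ↔ Linked (1 : G) ξ η := by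
  rw [← mul_inv_cancel (1 : G)]
  exact Subtype.ext_iff.trans (mk_eq_mk_iff hN (p := (ξ, 1)) (q := (η, 1)))

/-- The saturation of `C` is closed in every slice of the product with the discrete group, hence
closed. -/
theorem isClosedMap_point [Finite X] [Nonempty X] :
    IsClosedMap (point G : LeftSeq X → Tile G X) := by
  intro C hC
  let : TopologicalSpace G := ⊥
  have : DiscreteTopology G := ⟨rfl⟩
  let q : LeftSeq X × G → LimitGSpace G X := Quot.mk _
  have hclosed : IsClosed ((fun ξ => q (ξ, 1)) '' C) := by
    refine isClosed_coinduced.2 ?_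
    have hpre : q ⁻¹' ((fun ξ => q (ξ, 1)) '' C) = {p | ∃ ξ ∈ C, Linked p.2 ξ p.1} := by
      ext p
      refine exists_congr fun ξ => and_congr_right fun _ => ?_
      refine (mk_eq_mk_iff hN).trans ?_
      simp
    change IsClosed (q ⁻¹' _)
    rw [hpre, ← isOpen_compl_iff, isOpen_prod_iff]
    intro η g hηg
    exact ⟨{η | ∃ ξ ∈ C, Linked g ξ η}ᶜ, {g}, (isClosed_setOf_linked hN hC g).isOpen_compl,
      isOpen_discrete _, hηg, rfl, by rintro ⟨η', g'⟩ ⟨h1, rfl⟩; exact h1⟩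
  have hpre : point G '' C = Subtype.val ⁻¹' ((fun ξ => q (ξ, 1)) '' C) := by
    ext t
    exact exists_congr fun ξ => and_congr_right fun _ => Subtype.ext_iff
  rw [hpre]
  exact hclosed.preimage continuous_subtype_val

theorem t1Space_tile [Finite X] [Nonempty X] : T1Space (Tile G X) := by
  refine ⟨fun t => ?_⟩
  obtain ⟨ξ, rfl⟩ := surjective_point t
  rw [← Set.image_singleton]
  exact isClosedMap_point hN _ isClosed_singleton

/-! ### Tiles -/

omit hN in
theorem levelTile_eq_range (v : List X) :
    levelTile G v = Set.range fun ξ : LeftSeq X => point G (ξ.append v) := by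
  ext t
  constructor
  · rintro ⟨ξ, hξ, rfl⟩
    refine ⟨ξ.shift v.length, ?_⟩
    have := append_shift ξ v.length
    rw [show lastWord ξ v.length = v from hξ] at this
    simp only [this]
  · rintro ⟨ξ, rfl⟩
    exact ⟨_, lastWord_append_length ξ v, rfl⟩

omit hN in
theorem point_mem_levelTile (ξ : LeftSeq X) (n : ℕ) :
    point G ξ ∈ levelTile G (lastWord ξ n) :=
  ⟨ξ, by simp [length_lastWord], rfl⟩

omit hN in
theorem exists_mem_levelTile (t : Tile G X) (n : ℕ) :
    ∃ v : List X, v.length = n ∧ t ∈ levelTile G v := by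
  obtain ⟨ξ, rfl⟩ := surjective_point t
  exact ⟨_, length_lastWord ξ n, point_mem_levelTile ξ n⟩

omit hN in
theorem levelTile_lastWord_antitone (ξ : LeftSeq X) :
    Antitone fun n => levelTile G (lastWord ξ n) := by
  refine antitone_nat_of_succ_le fun n => ?_
  rintro _ ⟨η, hη, rfl⟩
  refine ⟨η, ?_, rfl⟩
  simp only [length_lastWord, Set.mem_ofPred_eq] at hη ⊢
  exact lastWord_eq_of_le n.le_succ hη

theorem isClosed_levelTile [Finite X] [Nonempty X] (v : List X) : IsClosed (levelTile G v) :=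
  isClosedMap_point hN _ (isClosed_lastWord_eq _ _)

/-- Appending `v` respects equivalence, since 1 fixes `v` and restricts to 1. It therefore descends
to a continuous map of the connected tile onto the level tile. -/
theorem isPreconnected_levelTile [Finite X] [Nonempty X] [ConnectedSpace (Tile G X)]
    (v : List X) : IsPreconnected (levelTile G v) := by
  have hq : IsQuotientMap (point G : LeftSeq X → Tile G X) :=
    (isClosedMap_point hN).isQuotientMap continuous_point surjective_point
  let f : Tile G X → Tile G X := fun t => point G ((Function.surjInv surjective_point t).append v)
  have hf : ∀ ξ, f (point G ξ) = point G (ξ.append v) := by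
    intro ξ
    have h := (point_eq_point_iff hN).1
      (Function.surjInv_eq (surjective_point (G := G) (X := X)) (point G ξ))
    have h2 := h.append hN v
    rw [one_smul, restrWord_one] at h2
    exact (point_eq_point_iff hN).2 h2
  have hcont : Continuous f := by
    rw [hq.continuous_iff]
    have : f ∘ point G = fun ξ => point G (ξ.append v) := funext hf
    rw [this]
    exact continuous_point.comp (continuous_append v)
  have hrange : levelTile G v = Set.range f := by
    rw [levelTile_eq_range, ← surjective_point.range_comp f]
    exact congrArg Set.range (funext fun ξ => (hf ξ).symm)
  rw [hrange]
  exact isPreconnected_range hcont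

omit hN in
theorem nonempty_levelTile [Nonempty X] (v : List X) : (levelTile G v).Nonempty := by
  rw [levelTile_eq_range]
  exact ⟨_, (fun _ => Classical.arbitrary X : LeftSeq X), rfl⟩

theorem finite_point_fiber [Nonempty X] (t : Tile G X) : (point G ⁻¹' {t}).Finite := by
  obtain ⟨ξ, rfl⟩ := surjective_point t
  exact (finite_linked hN ξ).subset fun η hη =>
    ⟨1, (point_eq_point_iff hN).1 (Set.mem_singleton_iff.1 hη).symm⟩

/-- Infinitely many sequences end in `v`, and each point has finitely many representatives. -/
theorem infinite_levelTile [Nontrivial X] (v : List X) : (levelTile G v).Infinite := by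
  intro hfin
  have h1 : (point G ⁻¹' levelTile G v).Finite :=
    hfin.preimage' fun t _ => finite_point_fiber hN t
  have h2 : Set.range (fun ξ : LeftSeq X => ξ.append v) ⊆ point G ⁻¹' levelTile G v := by
    rintro _ ⟨ξ, rfl⟩
    exact ⟨_, lastWord_append_length ξ v, rfl⟩
  exact Set.infinite_range_of_injective (append_injective v) (h1.subset h2)

theorem exists_linked_of_mem_inter [Nonempty X] {v u : List X} (hvu : v.length = u.length)
    {t : Tile G X} (ht : t ∈ levelTile G v ∩ levelTile G u) :
    ∃ (ξ η : LeftSeq X) (g : G), Linked g ξ η ∧ t = point G (ξ.append v) ∧ g • v = u ∧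
      restrWord g v = 1 := by
  obtain ⟨⟨ξ, hξ, rfl⟩, η, hη, h⟩ := ht
  obtain ⟨r, hr, h1, h2⟩ := ((point_eq_point_iff hN).1 h.symm).exists_shift v.length
  have happ := append_shift ξ v.length
  simp only [Set.mem_ofPred_eq] at hξ hη
  rw [hξ] at h1 h2 happ
  rw [hvu, hη] at h1
  exact ⟨_, _, r, hr, by rw [happ], h1, h2⟩

/-- Tiles of the same level intersect if and only if the corresponding vertices of the tile graph
are equal or adjacent. -/
theorem nonempty_inter_iff [Nonempty X] {v u : List X} (hvu : v.length = u.length) :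
    (levelTile G v ∩ levelTile G u).Nonempty ↔
      ∃ s ∈ nucleus G X, s • v = u ∧ restrWord s v = 1 := by
  constructor
  · rintro ⟨t, ht⟩
    obtain ⟨ξ, η, g, hg, -, h1, h2⟩ := exists_linked_of_mem_inter hN hvu ht
    exact ⟨g, hg.mem_nucleus, h1, h2⟩
  · rintro ⟨s, hs, rfl, h⟩
    -- A path ending in `s`, continued by reading `v`, ends in 1 and identifies a point of one tile
    -- with a point of the other.
    obtain ⟨ξ, η, hl⟩ := exists_linked_of_mem_nucleus hN hs
    have hl' := hl.append hN v
    rw [h] at hl'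
    exact ⟨_, ⟨_, lastWord_append_length ξ v, rfl⟩, _, lastWord_append_length η (s • v),
      ((point_eq_point_iff hN).2 hl').symm⟩

/-- The identifying path passes through a state moving `v` to `u`; this state is nontrivial, so the
remaining left part of the sequence is post-critical. -/
theorem finite_inter_levelTile [Nonempty X] (hP : (postCritical G X).Finite) {v u : List X}
    (hvu : v.length = u.length) (hne : v ≠ u) : (levelTile G v ∩ levelTile G u).Finite := by
  refine (hP.image fun ξ => point G (ξ.append v)).subset fun t ht => ?_
  obtain ⟨ξ, η, g, hg, rfl, h1, h2⟩ := exists_linked_of_mem_inter hN hvu ht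
  refine ⟨ξ, mem_postCritical_iff.2 ⟨g, η, ?_, hg⟩, rfl⟩
  rintro rfl
  exact hne (by simpa using h1)

theorem nonempty_levelTile_inter_boundaryPoints_iff [Nonempty X] (v : List X) :
    (levelTile G v ∩ boundaryPoints G X).Nonempty ↔
      ∃ p ∈ postCritical G X, v = lastWord p v.length := by
  constructor
  · rintro ⟨_, ⟨ξ, hξ, rfl⟩, p, hp, h⟩
    exact ⟨ξ, mem_postCritical_of_linked hN ((point_eq_point_iff hN).1 h.symm) hp, hξ.symm⟩
  · rintro ⟨p, hp, hv⟩
    exact ⟨point G p, ⟨p, hv.symm, rfl⟩, p, hp, rfl⟩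

/-- The complement of the interior of a tile is the union of the other tiles of its level. -/
theorem compl_interior_levelTile [Finite X] [Nontrivial X] [ConnectedSpace (Tile G X)]
    (hP : (postCritical G X).Finite) {n : ℕ} (v : {v : List X // v.length = n}) :
    (interior (levelTile G v.1))ᶜ =
      ⋃ u : {u : {v : List X // v.length = n} // u ≠ v}, levelTile G u.1.1 := by
  have : Finite {v : List X // v.length = n} := List.finite_length_eq X n
  have := t1Space_tile hN
  apply Set.Subset.antisymm
  · rw [Set.compl_subset_comm]
    refine interior_maximal (fun t ht => ?_) ?_
    · obtain ⟨u, hu, htu⟩ := exists_mem_levelTile t n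
      by_cases huv : (⟨u, hu⟩ : {v : List X // v.length = n}) = v
      · rwa [← huv]
      · exact absurd (Set.mem_iUnion.2 ⟨⟨⟨u, hu⟩, huv⟩, htu⟩) ht
    · exact (isClosed_iUnion_of_finite fun u => isClosed_levelTile hN _).isOpen_compl
  · refine Set.iUnion_subset fun ⟨u, huv⟩ p hp hpv => ?_
    have hfin : (levelTile G v.1 ∩ levelTile G u.1).Finite :=
      finite_inter_levelTile hN hP (v.2.trans u.2.symm) fun h => huv (Subtype.ext h.symm)
    -- Deleting the other common points leaves an open set meeting the tile of `u` only in `p`. Then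
    -- `p` would be isolated in an infinite connected T1 space.
    have hO : IsOpen (interior (levelTile G v.1) \ ((levelTile G v.1 ∩ levelTile G u.1) \ {p})) :=
      isOpen_interior.sdiff (hfin.subset Set.sdiff_subset).isClosed
    obtain ⟨q, hq, hqp⟩ : ∃ q ∈ levelTile G u.1, q ≠ p := by
      by_contra! h
      exact infinite_levelTile hN u.1 ((Set.finite_singleton p).subset h)
    obtain ⟨r, hr, ⟨hr1, hr2⟩, hr3⟩ := isPreconnected_levelTile hN u.1 _ _ hO
      (isOpen_compl_singleton (x := p)) (fun r hr => by
        by_cases h : r = p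
        · subst h
          exact Or.inl ⟨hpv, fun h => h.2 rfl⟩
        · exact Or.inr h) ⟨p, hp, hpv, fun h => h.2 rfl⟩ ⟨q, hq, hqp⟩
    exact hr2 ⟨⟨interior_subset hr1, hr⟩, hr3⟩

/-- Every point has a connected neighborhood that consists of the tiles of a given level that
contain the point. -/
theorem exists_preconnected_nhds [Finite X] [Nonempty X] [ConnectedSpace (Tile G X)]
    (t : Tile G X) (n : ℕ) : ∃ U ∈ 𝓝 t, IsPreconnected U ∧
      ∀ z ∈ U, ∃ u : List X, u.length = n ∧ t ∈ levelTile G u ∧ z ∈ levelTile G u := by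
  have hfin := List.finite_length_eq X n
  refine ⟨⋃₀ (levelTile G '' {u | u.length = n ∧ t ∈ levelTile G u}), ?_, ?_, ?_⟩
  · have hclosed : IsClosed (⋃ u ∈ {u : List X | u.length = n ∧ t ∉ levelTile G u},
        levelTile G u) :=
      (hfin.subset fun u hu => hu.1).isClosed_biUnion fun u _ => isClosed_levelTile hN u
    refine Filter.mem_of_superset (hclosed.isOpen_compl.mem_nhds ?_) ?_
    · simp only [Set.mem_compl_iff, Set.mem_iUnion, not_exists]
      exact fun u hu htu => hu.2 htu
    · intro z hz
      obtain ⟨u, hu, hzu⟩ := exists_mem_levelTile z n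
      by_cases htu : t ∈ levelTile G u
      · exact ⟨_, ⟨u, ⟨hu, htu⟩, rfl⟩, hzu⟩
      · exact absurd (Set.mem_iUnion₂.2 ⟨u, ⟨hu, htu⟩, hzu⟩) hz
  · refine isPreconnected_sUnion t _ ?_ ?_
    · rintro _ ⟨u, hu, rfl⟩
      exact hu.2
    · rintro _ ⟨u, hu, rfl⟩
      exact isPreconnected_levelTile hN u
  · rintro z ⟨_, ⟨u, hu, rfl⟩, hz⟩
    exact ⟨u, hu.1, hu.2, hz⟩

/-- A sequence is determined up to asymptotic equivalence by its tiles. -/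
theorem eq_point_of_forall_mem_levelTile [Nonempty X] {t : Tile G X} {ξ : LeftSeq X}
    (h : ∀ n, t ∈ levelTile G (lastWord ξ n)) : t = point G ξ := by
  have hfin := finite_point_fiber hN t
  by_contra hne
  -- Finitely many sequences represent `t`, so one level separates all of them from `ξ`.
  have hsep : ∀ η : LeftSeq X, ∃ n, point G η = t → lastWord η n ≠ lastWord ξ n := by
    intro η
    by_contra! hno
    rw [LeftSeq.ext_lastWord fun n => (hno n).2] at hno
    exact hne (hno 0).1.symm
  choose d hd using hsep
  obtain ⟨η, hη, hηt⟩ := h (hfin.toFinset.sup d)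
  simp only [length_lastWord, Set.mem_ofPred_eq] at hη
  exact hd η hηt (lastWord_eq_of_le (Finset.le_sup (f := d) (by simpa using hηt)) hη)

end TileTopology

/-! ### Components of finite and of increasing unions -/

section Components

variable {Y : Type*} [TopologicalSpace Y]

/-- The components of a finite union of closed connected sets are described by the intersection
graph. -/
theorem connectedComponentIn_iUnion {ι : Type*} [Finite ι] {T : ι → Set Y}
    (hclosed : ∀ i, IsClosed (T i)) (hconn : ∀ i, IsPreconnected (T i)) {Γ : SimpleGraph ι}
    (hΓ : ∀ i j, i ≠ j → (Γ.Adj i j ↔ (T i ∩ T j).Nonempty)) {i : ι} {x : Y} (hx : x ∈ T i) :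
    connectedComponentIn (⋃ j, T j) x = ⋃ j ∈ {j | Γ.Reachable i j}, T j := by
  have hxF : x ∈ ⋃ j ∈ {j | Γ.Reachable i j}, T j :=
    Set.mem_biUnion (SimpleGraph.Reachable.refl i) hx
  apply Set.Subset.antisymm
  · have hcover : connectedComponentIn (⋃ j, T j) x ⊆
        (⋃ j ∈ {j | Γ.Reachable i j}, T j) ∪ ⋃ j ∈ {j | ¬ Γ.Reachable i j}, T j := by
      intro y hy
      obtain ⟨j, hj⟩ := Set.mem_iUnion.1 (connectedComponentIn_subset _ _ hy)
      by_cases h : Γ.Reachable i j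
      · exact Or.inl (Set.mem_biUnion (t := T) h hj)
      · exact Or.inr (Set.mem_biUnion (t := T) h hj)
    have hF : ∀ S : Set ι, IsClosed (⋃ j ∈ S, T j) := fun S =>
      S.toFinite.isClosed_biUnion fun j _ => hclosed j
    intro y hy
    rcases hcover hy with h | h
    · exact h
    · obtain ⟨z, -, hz1, hz2⟩ := isPreconnected_closed_iff.1
        (isPreconnected_connectedComponentIn (F := ⋃ j, T j) (x := x)) _ _ (hF _) (hF _) hcover
        ⟨x, mem_connectedComponentIn (Set.mem_iUnion.2 ⟨i, hx⟩), hxF⟩ ⟨y, hy, h⟩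
      obtain ⟨j, hj, hzj⟩ := Set.mem_iUnion₂.1 hz1
      obtain ⟨k, hk, hzk⟩ := Set.mem_iUnion₂.1 hz2
      have hjk : j ≠ k := by
        rintro rfl
        exact hk hj
      exact absurd (SimpleGraph.Reachable.trans hj ((hΓ j k hjk).2 ⟨z, hzj, hzk⟩).reachable) hk
  · refine IsPreconnected.subset_connectedComponentIn ?_ hxF
      (Set.iUnion₂_subset fun j _ => Set.subset_iUnion T j)
    refine isPreconnected_of_forall x fun y hy => ?_
    obtain ⟨j, hj, hyj⟩ := Set.mem_iUnion₂.1 hy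
    clear hy
    rw [Set.mem_ofPred_eq, SimpleGraph.reachable_iff_reflTransGen] at hj
    induction hj generalizing y with
    | refl => exact ⟨T i, Set.subset_biUnion_of_mem (u := T) (SimpleGraph.Reachable.refl i),
        hx, hyj, hconn i⟩
    | @tail j k hij hjk ih =>
      obtain ⟨z, hzj, hzk⟩ := (hΓ j k hjk.ne).1 hjk
      obtain ⟨U, hU, hxU, hzU, hUc⟩ := ih z hzj
      have hik : Γ.Reachable i k :=
        ((SimpleGraph.reachable_iff_reflTransGen _ _).2 hij).trans hjk.reachable
      exact ⟨U ∪ T k, Set.union_subset hU (Set.subset_biUnion_of_mem (u := T) hik), Or.inl hxU,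
        Or.inr hyj, hUc.union z hzU hzk (hconn k)⟩

/-- The components of a finite union of closed connected sets that meet `P` are counted by the
components of the intersection graph. -/
theorem encard_components_iUnion {ι : Type*} [Finite ι] {T : ι → Set Y}
    (hclosed : ∀ i, IsClosed (T i)) (hconn : ∀ i, IsPreconnected (T i))
    (hne : ∀ i, (T i).Nonempty) {Γ : SimpleGraph ι}
    (hΓ : ∀ i j, i ≠ j → (Γ.Adj i j ↔ (T i ∩ T j).Nonempty)) (P : Set Y) :
    {C : Set Y | (∃ x ∈ ⋃ i, T i, C = connectedComponentIn (⋃ i, T i) x) ∧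
      (C ∩ P).Nonempty}.encard =
    {c : Γ.ConnectedComponent | ∃ i ∈ c.supp, (T i ∩ P).Nonempty}.encard := by
  let Φ : Γ.ConnectedComponent → Set Y := fun c => ⋃ j ∈ c.supp, T j
  have hΦ : ∀ i x, x ∈ T i →
      connectedComponentIn (⋃ j, T j) x = Φ (Γ.connectedComponentMk i) := by
    intro i x hx
    rw [connectedComponentIn_iUnion hclosed hconn hΓ hx]
    have : (Γ.connectedComponentMk i).supp = {j | Γ.Reachable i j} := by
      ext j
      rw [SimpleGraph.ConnectedComponent.mem_supp_iff, SimpleGraph.ConnectedComponent.eq]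
      exact SimpleGraph.reachable_comm
    simp only [Φ, this]
  have hinj : Function.Injective Φ := by
    intro c d hcd
    induction c using SimpleGraph.ConnectedComponent.ind with
    | _ i =>
    induction d using SimpleGraph.ConnectedComponent.ind with
    | _ j =>
    obtain ⟨x, hx⟩ := hne i
    have hxj : x ∈ Φ (Γ.connectedComponentMk j) := hcd ▸ Set.mem_biUnion (t := T) rfl hx
    obtain ⟨k, hk, hxk⟩ := Set.mem_iUnion₂.1 hxj
    rw [← (SimpleGraph.ConnectedComponent.mem_supp_iff _ _).1 hk]
    by_cases hik : i = k
    · rw [hik]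
    · exact SimpleGraph.ConnectedComponent.sound ((hΓ i k hik).2 ⟨x, hx, hxk⟩).reachable
  rw [← hinj.encard_image]
  congr 1
  ext C
  constructor
  · rintro ⟨⟨x, hx, rfl⟩, y, hy, hyP⟩
    obtain ⟨i, hxi⟩ := Set.mem_iUnion.1 hx
    rw [hΦ i x hxi] at hy ⊢
    obtain ⟨j, hj, hyj⟩ := Set.mem_iUnion₂.1 hy
    exact ⟨_, ⟨j, hj, y, hyj, hyP⟩, rfl⟩
  · rintro ⟨c, ⟨i, hi, y, hyi, hyP⟩, rfl⟩
    refine ⟨⟨y, Set.mem_iUnion.2 ⟨i, hyi⟩, ?_⟩, y, Set.mem_biUnion (t := T) hi hyi, hyP⟩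
    rw [hΦ i y hyi, (SimpleGraph.ConnectedComponent.mem_supp_iff _ _).1 hi]

/-- The components of an increasing union are the increasing unions of the components if every
point has a connected neighborhood inside one of the sets. -/
theorem connectedComponentIn_eq_iUnion {A : ℕ → Set Y} (hA : Monotone A) {Ω : Set Y}
    (hΩ : ∀ n, A n ⊆ Ω) (hloc : ∀ z ∈ Ω, ∃ m, ∃ U ∈ 𝓝 z, IsPreconnected U ∧ U ⊆ A m) {x : Y}
    (hx : x ∈ Ω) : connectedComponentIn Ω x = ⋃ n, connectedComponentIn (A n) x := by
  have hmono : ∀ {m n}, m ≤ n → connectedComponentIn (A m) x ⊆ connectedComponentIn (A n) x :=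
    fun h => connectedComponentIn_mono x (hA h)
  apply Set.Subset.antisymm
  swap
  · exact Set.iUnion_subset fun n => connectedComponentIn_mono x (hΩ n)
  set D := ⋃ n, connectedComponentIn (A n) x
  -- Local connected neighborhoods lie entirely in `D` or entirely outside it, so `D` is relatively
  -- clopen in the component.
  have key : ∀ z ∈ Ω, ∃ U ∈ 𝓝 z, (U ∩ D).Nonempty → U ⊆ D := by
    intro z hz
    obtain ⟨m, U, hU, hUc, hUA⟩ := hloc z hz
    refine ⟨U, hU, ?_⟩
    rintro ⟨y, hyU, hyD⟩
    obtain ⟨n, hn⟩ := Set.mem_iUnion.1 hyD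
    have hy := hmono (le_max_right m n) hn
    refine (hUc.subset_connectedComponentIn hyU (hUA.trans (hA (le_max_left m n)))).trans ?_
    rw [← connectedComponentIn_eq hy]
    exact Set.subset_iUnion (fun n => connectedComponentIn (A n) x) _
  have hxD : x ∈ D := by
    obtain ⟨m, U, hU, -, hUA⟩ := hloc x hx
    exact Set.mem_iUnion.2 ⟨m, mem_connectedComponentIn (hUA (mem_of_mem_nhds hU))⟩
  intro y hy
  by_contra hyD
  obtain ⟨z, hz, hz1, hz2⟩ := isPreconnected_connectedComponentIn (F := Ω) (x := x)
    (interior D) (interior Dᶜ) isOpen_interior isOpen_interior (fun z hz => by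
      obtain ⟨U, hU, hUD⟩ := key z (connectedComponentIn_subset _ _ hz)
      by_cases h : (U ∩ D).Nonempty
      · exact Or.inl (mem_interior_iff_mem_nhds.2 (mem_of_superset hU (hUD h)))
      · exact Or.inr (mem_interior_iff_mem_nhds.2 (mem_of_superset hU fun w hw hwD =>
          h ⟨w, hw, hwD⟩)))
    ⟨x, mem_connectedComponentIn hx, by
      obtain ⟨U, hU, hUD⟩ := key x hx
      exact mem_interior_iff_mem_nhds.2 (mem_of_superset hU
        (hUD ⟨x, mem_of_mem_nhds hU, hxD⟩))⟩
    ⟨y, hy, by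
      obtain ⟨U, hU, hUD⟩ := key y (connectedComponentIn_subset _ _ hy)
      exact mem_interior_iff_mem_nhds.2 (mem_of_superset hU fun w hw hwD =>
        hyD (hUD ⟨w, hw, hwD⟩ (mem_of_mem_nhds hU)))⟩
  exact interior_subset hz2 (interior_subset hz1)

/-- Components meeting `P` are indexed by points of `P`, which turns counting them into comparing
two maps on a fixed finite set. -/
theorem setOf_components_eq_image (A P : Set Y) :
    {C : Set Y | (∃ x ∈ A, C = connectedComponentIn A x) ∧ (C ∩ P).Nonempty} =
      connectedComponentIn A '' (P ∩ A) := by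
  ext C
  constructor
  · rintro ⟨⟨x, hx, rfl⟩, y, hy, hyP⟩
    exact ⟨y, ⟨hyP, connectedComponentIn_subset _ _ hy⟩, (connectedComponentIn_eq hy).symm⟩
  · rintro ⟨y, ⟨hyP, hyA⟩, rfl⟩
    exact ⟨⟨y, hyA, rfl⟩, y, mem_connectedComponentIn hyA, hyP⟩

theorem encard_image_le_encard_image {α β γ : Type*} {f : α → β} {g : α → γ} {S : Set α}
    (h : ∀ p ∈ S, ∀ q ∈ S, f p = f q → g p = g q) : (g '' S).encard ≤ (f '' S).encard := by
  rcases S.eq_empty_or_nonempty with rfl | ⟨a, ha⟩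
  · simp
  have : Nonempty α := ⟨a⟩
  refine (Set.encard_le_encard ?_).trans
    (Set.encard_image_le (fun y => g (Function.invFunOn f S y)) (f '' S))
  rintro _ ⟨p, hp, rfl⟩
  have hex : ∃ q ∈ S, f q = f p := ⟨p, hp, rfl⟩
  exact ⟨f p, ⟨p, hp, rfl⟩,
    h _ (Function.invFunOn_mem hex) _ hp (Function.invFunOn_eq hex)⟩

/-- The number of components of an increasing union that meet a finite set stabilizes. -/
theorem eventually_encard_components_eq {A : ℕ → Set Y} (hA : Monotone A) {Ω : Set Y}
    (hΩ : ∀ n, A n ⊆ Ω) (hloc : ∀ z ∈ Ω, ∃ m, ∃ U ∈ 𝓝 z, IsPreconnected U ∧ U ⊆ A m) {P : Set Y}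
    (hP : P.Finite) : ∀ᶠ n in atTop,
      {C : Set Y | (∃ x ∈ A n, C = connectedComponentIn (A n) x) ∧ (C ∩ P).Nonempty}.encard =
      {C : Set Y | (∃ x ∈ Ω, C = connectedComponentIn Ω x) ∧ (C ∩ P).Nonempty}.encard := by
  have h1 : ∀ p ∈ P ∩ Ω, ∀ᶠ n in atTop, p ∈ A n := by
    intro p hp
    obtain ⟨m, U, hU, -, hUA⟩ := hloc p hp.2
    exact eventually_atTop.2 ⟨m, fun n hn => hA hn (hUA (mem_of_mem_nhds hU))⟩
  -- Two points in one component of `Ω` already lie in one component of some `A m`; finitely many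
  -- pairs give a common level.
  have h2 : ∀ pq ∈ (P ∩ Ω) ×ˢ (P ∩ Ω), ∀ᶠ n in atTop,
      connectedComponentIn Ω pq.1 = connectedComponentIn Ω pq.2 →
        pq.2 ∈ connectedComponentIn (A n) pq.1 := by
    rintro ⟨p, q⟩ ⟨hp, hq⟩
    by_cases heq : connectedComponentIn Ω p = connectedComponentIn Ω q
    · have hqp : q ∈ connectedComponentIn Ω p := heq ▸ mem_connectedComponentIn hq.2
      rw [connectedComponentIn_eq_iUnion hA hΩ hloc hp.2] at hqp
      obtain ⟨m, hm⟩ := Set.mem_iUnion.1 hqp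
      exact eventually_atTop.2 ⟨m, fun n hn _ => connectedComponentIn_mono p (hA hn) hm⟩
    · exact Eventually.of_forall fun n h => absurd h heq
  have hPΩ : (P ∩ Ω).Finite := hP.subset Set.inter_subset_left
  filter_upwards [(eventually_all_finite hPΩ).2 h1,
    (eventually_all_finite (hPΩ.prod hPΩ)).2 h2] with n hn1 hn2
  have hPA : P ∩ A n = P ∩ Ω := Set.Subset.antisymm
    (Set.inter_subset_inter_right _ (hΩ n)) fun p hp => ⟨hp.1, hn1 p hp⟩
  rw [setOf_components_eq_image, setOf_components_eq_image, hPA]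
  apply le_antisymm
  · exact encard_image_le_encard_image fun p hp q hq h =>
      connectedComponentIn_eq (hn2 (p, q) ⟨hp, hq⟩ h)
  · refine encard_image_le_encard_image fun p hp q hq h => ?_
    have hqp : q ∈ connectedComponentIn (A n) p := h ▸ mem_connectedComponentIn (hn1 q hq)
    exact connectedComponentIn_eq (connectedComponentIn_mono p (hΩ n) hqp)

end Components

/-! ### Components of the punctured tile graph -/

section Counting

variable {G X : Type*} [Group G] [MulAction G (List X)] [SelfSimilar G X]

theorem bc_compl_interior_eq_pc [Finite X] [Nontrivial X] [ConnectedSpace (Tile G X)]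
    (hN : ∃ N : Set G, IsContractingSet G X N) (hP : (postCritical G X).Finite) {n : ℕ}
    (v : {v : List X // v.length = n}) :
    bc (interior (levelTile G v.1))ᶜ = pc G n v := by
  have : Finite {v : List X // v.length = n} := List.finite_length_eq X n
  rw [bc, compl_interior_levelTile hN hP v, pc]
  rw [encard_components_iUnion
    (T := fun u : {u : {v : List X // v.length = n} // u ≠ v} => levelTile G u.1.1) (Γ := (tileGraph G X n).induce {u | u ≠ v})
    (fun u => isClosed_levelTile hN _) (fun u => isPreconnected_levelTile hN _)
    (fun u => nonempty_levelTile _)]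
  · congr 1
    ext c
    refine exists_congr fun u => and_congr_right fun _ => ?_
    rw [nonempty_levelTile_inter_boundaryPoints_iff hN, u.1.2]
  · intro u w huw
    have huw' : u.1 ≠ w.1 := fun h => huw (Subtype.ext h)
    have hlen : u.1.1.length = w.1.1.length := u.1.2.trans w.1.2.symm
    rw [SimpleGraph.comap_adj, tileGraph, SimpleGraph.fromRel_adj]
    simp only [Function.Embedding.subtype_apply]
    rw [← nonempty_inter_iff hN hlen, ← nonempty_inter_iff hN hlen.symm,
      Set.inter_comm (levelTile G w.1.1), or_self]
    exact and_iff_right huw'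

end Counting

end SelfSimilarTile

theorem mainTheorem11 {X : Type*} [Finite X] [Nontrivial X]
    {G : Type*} [Group G] [MulAction G (List X)] [SelfSimilar G X]
    (hG : GeneratedByBoundedAutomaton G X)
    (hconn : ConnectedSpace (Tile G X))
    (t : Tile G X) (ht : IsRegularPoint t) (ξ : LeftSeq X) (hξ : point G ξ = t) :
    bc ({t}ᶜ : Set (Tile G X)) ≠ ⊤ ∧
    Tendsto (fun n : ℕ => bc (interior (levelTile G (lastWord ξ n)))ᶜ) atTop
      (𝓝 (bc ({t}ᶜ : Set (Tile G X)))) ∧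
    Tendsto (fun n : ℕ => pc G n ⟨lastWord ξ n, length_lastWord ξ n⟩) atTop
      (𝓝 (bc ({t}ᶜ : Set (Tile G X)))) := by
  have hN := hG.exists_isContractingSet
  have hP : (postCritical G X).Finite := finite_postCritical hN hG.isBoundedElement
  have hB : (boundaryPoints G X).Finite := hP.image _
  have hcompl : ∀ n, (interior (levelTile G (lastWord ξ n)))ᶜ =
      ⋃ u : {u : {v : List X // v.length = n} // u ≠ ⟨lastWord ξ n, length_lastWord ξ n⟩},
        levelTile G u.1.1 :=
    fun n => compl_interior_levelTile hN hP ⟨lastWord ξ n, length_lastWord ξ n⟩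
  have hev : ∀ᶠ n in atTop, bc (interior (levelTile G (lastWord ξ n)))ᶜ =
      bc ({t}ᶜ : Set (Tile G X)) := by
    refine eventually_encard_components_eq
      (A := fun n => (interior (levelTile G (lastWord ξ n)))ᶜ) ?_ ?_ ?_ hB
    · intro m n hmn
      exact Set.compl_subset_compl.2 (interior_mono (levelTile_lastWord_antitone ξ hmn))
    -- Regularity is used here: otherwise `t` would lie both in its own tile and in another tile of
    -- level `n`.
    · rintro n z hz rfl
      rw [hcompl n] at hz
      obtain ⟨⟨u, hu⟩, hzu⟩ := Set.mem_iUnion.1 hz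
      exact ht ⟨u.1, lastWord ξ n, by rw [u.2, length_lastWord], fun h => hu (Subtype.ext h), hzu,
        hξ ▸ point_mem_levelTile ξ n⟩
    · intro z hz
      obtain ⟨m, hm⟩ : ∃ m, z ∉ levelTile G (lastWord ξ m) := by
        by_contra! h
        exact hz ((eq_point_of_forall_mem_levelTile hN h).trans hξ)
      -- The level-`m` tiles containing `z` all differ from the tile of `ξ`, so their union lies in
      -- `A m`.
      obtain ⟨U, hU, hUc, hUt⟩ := exists_preconnected_nhds hN z m
      refine ⟨m, U, hU, hUc, fun y hy => ?_⟩
      obtain ⟨u, hu, hzu, hyu⟩ := hUt y hy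
      rw [hcompl]
      refine Set.mem_iUnion.2 ⟨⟨⟨u, hu⟩, fun h => hm ?_⟩, hyu⟩
      rwa [← Subtype.mk.inj h]
  refine ⟨?_, tendsto_nhds_of_eventually_eq hev, tendsto_nhds_of_eventually_eq ?_⟩
  · rw [bc, setOf_components_eq_image, Set.encard_ne_top_iff]
    exact (hB.subset Set.inter_subset_left).image _
  · filter_upwards [hev] with n hn
    rw [← hn, ← bc_compl_interior_eq_pc hN hP ⟨lastWord ξ n, length_lastWord ξ n⟩]
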